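/- Let $q$ be a prime power and let $V$ be an $O^+(8,q)$-space, i.e. an 8-dimensional $\mathbb F_q$-space with a quadratic form $Q$ whose polar form $(v,w)=Q(v+w)-Q(v)-Q(w)$ is nondegenerate and whose Witt index is 4. Perpendicularity ($\perp$) refers to the polar form; a subspace is totally singular if $Q$ vanishes on it, and totally isotropic if the polar form vanishes on it; a singular point is a totally singular 1-space. A partial spread of $V$ is a set of 4-dimensional subspaces any two of which meet only in $0$; it is orthogonal if its members are totally singular and symplectic if its members are totally isotropic. A partial ovoid is a set of singular points such that each maximal totally singular subspace contains at most one of them. Maximal always means maximal with respect to inclusion among sets of the same kind. A triality map is a permutation $\tau$ of the set of all singular points and totally singular 4-spaces of $V$ with $\tau^3=1$ that preserves incidence in both directions (a point is incident with the 4-spaces containing it, and two different 4-spaces are incident when they meet in a 3-space) and sends the points to 4-spaces of one type, where two totally singular 4-spaces have the same type if and only if the dimension of their intersection is even. Then $V$ has a maximal orthogonal partial spread $\Sigma$ of size $2q^2+1$; if $q$ is even, then $\Sigma$ is also a maximal symplectic partial spread. Moreover, $\Sigma$ can be chosen of the form $\Omega^\tau$, where $\tau$ is a triality map of $V$ and $\Omega$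 is a maximal partial ovoid of the following kind. There are non-perpendicular subspaces $U,U'$ of type $O^-(4,q)$ (4-dimensional, with nondegenerate polar form and Witt index 1), singular points $p\le U$ and $p'\le U'$ with $p^\perp\cap U\perp U'$ and $p'^\perp\cap U'\perp U$, and a point $x\ne p,p'$ of the line $\langle p,p'\rangle$, such that $$\Omega=\big(\Omega_U\setminus\{p\}\big)\cup\big(\Omega_{U'}\setminus\{p'\}\big)\cup\{x\},$$ where $\Omega_U$ and $\Omega_{U'}$ are the sets of singular points of $U$ and $U'$ (elliptic quadrics). -/

import Mathlib

namespace OrthogonalGeometry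

section Spaces

variable {K V : Type*} [Field K] [AddCommGroup V] [Module K V]

/-- A subspace on which the quadratic form vanishes identically: a totally singular subspace. -/
def IsTotallySingular (Q : QuadraticForm K V) (W : Submodule K V) : Prop :=
  ∀ w ∈ W, Q w = 0

/-- A subspace on which the bilinear form vanishes identically: a totally isotropic subspace. -/
def IsTotallyIsotropic (B : LinearMap.BilinForm K V) (W : Submodule K V) : Prop :=
  ∀ v ∈ W, ∀ w ∈ W, B v w = 0

/-- Two subspaces are perpendicular if all their vectors are, with respect to the polar form
`(v, w) ↦ Q (v + w) - Q v - Q w`. -/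
def Perpendicular (Q : QuadraticForm K V) (X Y : Submodule K V) : Prop :=
  ∀ v ∈ X, ∀ w ∈ Y, QuadraticMap.polar Q v w = 0

/-- The subspace of all vectors perpendicular to a given subspace. -/
def perp (Q : QuadraticForm K V) (X : Submodule K V) : Submodule K V :=
  LinearMap.BilinForm.orthogonal Q.polarBilin X

/-- The Witt index of `Q` is `k`: the largest dimension of a totally singular subspace is `k`. -/
def HasWittIndex (Q : QuadraticForm K V) (k : ℕ) : Prop :=
  IsGreatest {d : ℕ | ∃ W : Submodule K V, IsTotallySingular Q W ∧ Module.finrank K W = d} k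

/-- An `O⁺(8, q)`-space: a quadratic space of dimension 8 with nondegenerate polar form and
Witt index 4. -/
structure IsOPlus8 (Q : QuadraticForm K V) : Prop where
  finrank_eq : Module.finrank K V = 8
  nondegenerate : Q.polarBilin.Nondegenerate
  wittIndex : HasWittIndex Q 4

/-- An `O⁻(4, q)`-space: a quadratic space of dimension 4 with nondegenerate polar form and
Witt index 1. -/
structure IsOMinus4 (Q : QuadraticForm K V) : Prop where
  finrank_eq : Module.finrank K V = 4
  nondegenerate : Q.polarBilin.Nondegenerate
  wittIndex : HasWittIndex Q 1

/-- A singular point: a totally singular subspace of dimension 1. -/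
def IsSingularPoint (Q : QuadraticForm K V) (P : Submodule K V) : Prop :=
  IsTotallySingular Q P ∧ Module.finrank K P = 1

/-- The set of singular points of a subspace `U`. -/
def singularPoints (Q : QuadraticForm K V) (U : Submodule K V) : Set (Submodule K V) :=
  {P | IsSingularPoint Q P ∧ P ≤ U}

/-- A partial ovoid: a set of singular points such that each maximal totally singular subspace
contains at most one of them. Maximality of partial ovoids is `Maximal (IsPartialOvoid Q) Ω`. -/
structure IsPartialOvoid (Q : QuadraticForm K V) (Ω : Set (Submodule K V)) : Prop where
  isSingularPoint : ∀ P ∈ Ω, IsSingularPoint Q P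
  at_most_one : ∀ M : Submodule K V, Maximal (IsTotallySingular Q) M →
    ∀ P ∈ Ω, ∀ P' ∈ Ω, P ≤ M → P' ≤ M → P = P'

/-- A partial spread of a `2n`-dimensional space: a set of `n`-dimensional subspaces, any two of
which have only `0` in common. -/
structure IsPartialSpread (S : Set (Submodule K V)) : Prop where
  finrank_eq : ∀ W ∈ S, 2 * Module.finrank K W = Module.finrank K V
  inf_eq_bot : ∀ W ∈ S, ∀ W' ∈ S, W ≠ W' → W ⊓ W' = ⊥

/-- An orthogonal partial spread: a partial spread of totally singular subspaces. -/
structure IsOrthogonalPartialSpread (Q : QuadraticForm K V) (S : Set (Submodule K V)) : Prop where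
  isPartialSpread : IsPartialSpread S
  isTotallySingular : ∀ W ∈ S, IsTotallySingular Q W

/-- A symplectic partial spread: a partial spread of totally isotropic subspaces. -/
structure IsSymplecticPartialSpread (B : LinearMap.BilinForm K V) (S : Set (Submodule K V)) :
    Prop where
  isPartialSpread : IsPartialSpread S
  isTotallyIsotropic : ∀ W ∈ S, IsTotallyIsotropic B W

end Spaces

section Triality

variable {K V : Type*} [Field K] [AddCommGroup V] [Module K V]

/-- The elements of the geometry of an `O⁺(8, q)`-space that are permuted by a triality: its
singular points and its totally singular 4-spaces (of both types). -/
def Element (Q : QuadraticForm K V) : Type _ :=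
  {W : Submodule K V // IsTotallySingular Q W ∧
    (Module.finrank K W = 1 ∨ Module.finrank K W = 4)}

/-- Incidence in the geometry of an `O⁺(8, q)`-space: a point is incident with the 4-spaces
containing it, and two different 4-spaces are incident if they meet in a 3-space. (Each element is
also incident with itself.) -/
def Incident (Q : QuadraticForm K V) (X Y : Element Q) : Prop :=
  X.1 ≤ Y.1 ∨ Y.1 ≤ X.1 ∨ Module.finrank K ↥(X.1 ⊓ Y.1) = 3

/-- A triality map: a permutation of order 3 of the points and 4-spaces that preserves incidence
and sends the points to 4-spaces of one type. Here two totally singular 4-spaces are of the same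
type if and only if the dimension of their intersection is even. -/
structure IsTriality (Q : QuadraticForm K V) (τ : Equiv.Perm (Element Q)) : Prop where
  incident_iff : ∀ X Y : Element Q, Incident Q (τ X) (τ Y) ↔ Incident Q X Y
  order_three : ∀ X : Element Q, τ (τ (τ X)) = X
  finrank_eq : ∀ X : Element Q, Module.finrank K X.1 = 1 → Module.finrank K (τ X).1 = 4
  same_type : ∀ X Y : Element Q, Module.finrank K X.1 = 1 → Module.finrank K Y.1 = 1 →
    Even (Module.finrank K ↥((τ X).1 ⊓ (τ Y).1))

/-- The image under `τ` of a set of points. -/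
def trialityImage (Q : QuadraticForm K V) (τ : Equiv.Perm (Element Q))
    (Ω : Set (Submodule K V)) : Set (Submodule K V) :=
  {W | ∃ X : Element Q, X.1 ∈ Ω ∧ (τ X).1 = W}

end Triality

section Construction

variable {K V : Type*} [Field K] [AddCommGroup V] [Module K V]

/-- `Ω` is made up of two elliptic quadrics, each with one point removed, and one extra point:
`U`, `U'` are non-perpendicular `O⁻(4, q)`-subspaces, `p`, `p'` are singular points of `U`, `U'`,
the tangent plane of `U` at `p` is perpendicular to `U'` and the tangent plane of `U'` at `p'` is
perpendicular to `U`, and `x` is a point of the line `⟨p, p'⟩` other than `p` and `p'`. -/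
def IsTwoQuadricConfiguration (Q : QuadraticForm K V) (Ω : Set (Submodule K V)) : Prop :=
  ∃ U U' p p' x : Submodule K V,
    IsOMinus4 (Q.comp U.subtype) ∧ IsOMinus4 (Q.comp U'.subtype) ∧
    ¬ Perpendicular Q U U' ∧
    p ∈ singularPoints Q U ∧ p' ∈ singularPoints Q U' ∧
    Perpendicular Q (perp Q p ⊓ U) U' ∧ Perpendicular Q (perp Q p' ⊓ U') U ∧
    Module.finrank K x = 1 ∧ x ≤ p ⊔ p' ∧ x ≠ p ∧ x ≠ p' ∧
    Ω = (singularPoints Q U \ {p}) ∪ (singularPoints Q U' \ {p'}) ∪ {x}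

end Construction

end OrthogonalGeometry

/-! The space is identified with the split octonions, whose para-multiplication x * y = x̄ȳ is a
symmetric composition: x * (y * x) = (x * y) * x = Q(x) y, with associative polar form. For singular
x ≠ 0 the spaces x * V and V * x are totally singular of dimension 4, and every totally singular
4-space is one of these (`eq_leftSpace_or_eq_flip`). The cycle P ↦ P * V ↦ V * P ↦ P is a triality,
since incidence between consecutive kinds always reads P * P' = 0 (`incident_toElement_iff`).

Under this triality perpendicularity becomes intersection: x * V and y * V meet in 0 if x, y are not
perpendicular, and in a 2-space if they are perpendicular and independent; x * V and V * y always
meet nontrivially. So pairwise non-perpendicular singular vectors yield both a partial ovoid and an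
orthogonal partial spread, and both are maximal once every vector is perpendicular to one of the
given ones.

Such vectors come from two elliptic frames `F`, `F'` that are perpendicular except for `F 1` and `F'
1` (`exists_linked_frames`). Each quadric without its point `F 0` or `F' 0` is parametrised by K ×
K, and `F 0 + F' 0` is the extra vector: 2q² + 1 in all. If z is not perpendicular to `F 0`, its
pairing with the points of the first quadric is a quadratic polynomial in two variables with
anisotropic leading form, which has a zero over a finite field; likewise for `F' 0`; if z is
perpendicular to both, it is perpendicular to their sum.

For q even, Q is semilinear on a totally isotropic 4-space, which therefore contains a totally
singular 3-space. That lies in some x * V, where it must meet a 2-space cut out by a member of the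
spread. -/

namespace OrthogonalGeometry

/-! ### Para-octonions as a symmetric composition -/

section SymmetricComposition

variable {K V : Type*} [Field K] [AddCommGroup V] [Module K V]

/-- A symmetric composition on a quadratic space. -/
structure IsSymmetricComposition (Q : QuadraticForm K V) (m : V →ₗ[K] V →ₗ[K] V) : Prop where
  left : ∀ x y, m x (m y x) = Q x • y
  right : ∀ x y, m (m x y) x = Q x • y
  assoc : ∀ x y z, QuadraticMap.polar Q (m x y) z = QuadraticMap.polar Q x (m y z)
  comp : ∀ x y, Q (m x y) = Q x * Q y

/-- The hyperbolic quadratic form on `K⁴ × K⁴`, as a function. -/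
def hyperbolicNorm (x : (Fin 4 → K) × (Fin 4 → K)) : K := ∑ i, x.1 i * x.2 i

/-- The para-octonion product on `K⁴ × K⁴`, as a function, for the split octonions in the form of
Zorn's vector matrices. -/
def paraZornFun (x y : (Fin 4 → K) × (Fin 4 → K)) : (Fin 4 → K) × (Fin 4 → K) :=
  (![x.2 0 * y.2 0 - (x.1 1 * y.2 1 + x.1 2 * y.2 2 + x.1 3 * y.2 3),
    -(x.2 0 * y.1 1 + y.1 0 * x.1 1) - (x.2 2 * y.2 3 - x.2 3 * y.2 2),
    -(x.2 0 * y.1 2 + y.1 0 * x.1 2) - (x.2 3 * y.2 1 - x.2 1 * y.2 3),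
    -(x.2 0 * y.1 3 + y.1 0 * x.1 3) - (x.2 1 * y.2 2 - x.2 2 * y.2 1)],
  ![x.1 0 * y.1 0 - (x.2 1 * y.1 1 + x.2 2 * y.1 2 + x.2 3 * y.1 3),
    -(y.2 0 * x.2 1 + x.1 0 * y.2 1) - (x.1 2 * y.1 3 - x.1 3 * y.1 2),
    -(y.2 0 * x.2 2 + x.1 0 * y.2 2) - (x.1 3 * y.1 1 - x.1 1 * y.1 3),
    -(y.2 0 * x.2 3 + x.1 0 * y.2 3) - (x.1 1 * y.1 2 - x.1 2 * y.1 1)])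

theorem paraZornFun_add_left (x x' y : (Fin 4 → K) × (Fin 4 → K)) :
    paraZornFun (x + x') y = paraZornFun x y + paraZornFun x' y := by
  ext i <;> fin_cases i <;> simp [paraZornFun] <;> ring

theorem paraZornFun_add_right (x y y' : (Fin 4 → K) × (Fin 4 → K)) :
    paraZornFun x (y + y') = paraZornFun x y + paraZornFun x y' := by
  ext i <;> fin_cases i <;> simp [paraZornFun] <;> ring

theorem paraZornFun_smul_left (k : K) (x y : (Fin 4 → K) × (Fin 4 → K)) :
    paraZornFun (k • x) y = k • paraZornFun x y := by
  ext i <;> fin_cases i <;> simp [paraZornFun] <;> ring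

theorem paraZornFun_smul_right (k : K) (x y : (Fin 4 → K) × (Fin 4 → K)) :
    paraZornFun x (k • y) = k • paraZornFun x y := by
  ext i <;> fin_cases i <;> simp [paraZornFun] <;> ring

/-- The para-octonion product as a bilinear map. -/
def paraZorn (K : Type*) [Field K] : (Fin 4 → K) × (Fin 4 → K) →ₗ[K]
    (Fin 4 → K) × (Fin 4 → K) →ₗ[K] (Fin 4 → K) × (Fin 4 → K) :=
  LinearMap.mk₂ K paraZornFun paraZornFun_add_left paraZornFun_smul_left paraZornFun_add_right
    paraZornFun_smul_right

theorem paraZorn_apply (x y : (Fin 4 → K) × (Fin 4 → K)) : paraZorn K x y = paraZornFun x y :=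
  rfl

/-- The product is x̄ȳ for the octonion conjugation, so x * (y * x) = x̄(xy), which is the norm of x
times y by alternativity. Here it is checked in coordinates. -/
theorem paraZorn_left (x y : (Fin 4 → K) × (Fin 4 → K)) :
    paraZorn K x (paraZorn K y x) = hyperbolicNorm x • y := by
  ext i <;> fin_cases i <;>
    simp [paraZorn_apply, paraZornFun, hyperbolicNorm, Fin.sum_univ_four] <;> ring

theorem paraZorn_right (x y : (Fin 4 → K) × (Fin 4 → K)) :
    paraZorn K (paraZorn K x y) x = hyperbolicNorm x • y := by
  ext i <;> fin_cases i <;>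
    simp [paraZorn_apply, paraZornFun, hyperbolicNorm, Fin.sum_univ_four] <;> ring

theorem hyperbolicNorm_paraZorn (x y : (Fin 4 → K) × (Fin 4 → K)) :
    hyperbolicNorm (paraZorn K x y) = hyperbolicNorm x * hyperbolicNorm y := by
  simp [paraZorn_apply, paraZornFun, hyperbolicNorm, Fin.sum_univ_four]; ring

theorem paraZorn_assoc (x y z : (Fin 4 → K) × (Fin 4 → K)) :
    QuadraticMap.polar hyperbolicNorm (paraZorn K x y) z =
      QuadraticMap.polar hyperbolicNorm x (paraZorn K y z) := by
  simp [QuadraticMap.polar, paraZorn_apply, paraZornFun, hyperbolicNorm, Fin.sum_univ_four]; ring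

end SymmetricComposition

/-! ### Hyperbolic coordinates in every characteristic -/

section HyperbolicCoordinates

variable {K V : Type*} [Field K] [AddCommGroup V] [Module K V]

theorem exists_dual_family {Q : QuadraticForm K V} [FiniteDimensional K V]
    (hQ : Q.polarBilin.Nondegenerate) {ι : Type*} [DecidableEq ι] {e : ι → V}
    (he : LinearIndependent K e) :
    ∃ f : ι → V, ∀ i j, QuadraticMap.polar Q (e i) (f j) = if i = j then 1 else 0 := by
  have h1 : ∀ j, ∃ f : V, ∀ i, QuadraticMap.polar Q (e i) f = if i = j then 1 else 0 := by
    intro j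
    obtain ⟨g, hg⟩ := LinearMap.dualMap_surjective_of_injective he (Finsupp.lapply j)
    refine ⟨(LinearMap.BilinForm.toDual Q.polarBilin hQ).symm g, fun i => ?_⟩
    rw [QuadraticMap.polar_comm, ← QuadraticMap.polarBilin_apply_apply,
      LinearMap.BilinForm.apply_toDual_symm_apply]
    simpa [Finsupp.single_apply] using LinearMap.congr_fun hg (Finsupp.single i 1)
  choose f hf using h1
  exact ⟨f, fun i j => hf j i⟩

theorem polar_sum_right (Q : QuadraticForm K V) {ι : Type*} (s : Finset ι) (x : V) (c : ι → K)
    (g : ι → V) : QuadraticMap.polar Q x (∑ j ∈ s, c j • g j) =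
      ∑ j ∈ s, c j * QuadraticMap.polar Q x (g j) := by
  have := map_sum (Q.polarBilin x) (fun j => c j • g j) s
  simpa only [QuadraticMap.polarBilin_apply_apply, QuadraticMap.polar_smul_right, smul_eq_mul]
    using this

theorem polar_sum_left (Q : QuadraticForm K V) {ι : Type*} (s : Finset ι) (x : V) (c : ι → K)
    (g : ι → V) : QuadraticMap.polar Q (∑ j ∈ s, c j • g j) x =
      ∑ j ∈ s, c j * QuadraticMap.polar Q (g j) x := by
  simp only [QuadraticMap.polar_comm Q _ x, polar_sum_right]

theorem map_sum_smul_eq_zero {Q : QuadraticForm K V} {ι : Type*} (s : Finset ι) (c : ι → K)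
    {g : ι → V} (hg : ∀ i, Q (g i) = 0)
    (hgg : ∀ i j, i ≠ j → QuadraticMap.polar Q (g i) (g j) = 0) :
    Q (∑ j ∈ s, c j • g j) = 0 := by
  classical
  induction s using Finset.induction_on with
  | empty => simp
  | insert a s ha ih =>
    rw [Finset.sum_insert ha, QuadraticMap.map_add Q, ih, QuadraticMap.map_smul, hg,
      polar_sum_right, Finset.sum_eq_zero]
    · simp
    · intro j hj
      rw [QuadraticMap.polar_smul_left, hgg a j (by rintro rfl; exact ha hj)]
      simp

/-- Every nondegenerate quadratic space of dimension 8 with a totally singular 4-space is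
hyperbolic. -/
theorem exists_hyperbolic_coordinates {Q : QuadraticForm K V} (h8 : Module.finrank K V = 8)
    (hQ : Q.polarBilin.Nondegenerate) {W : Submodule K V} (hW : IsTotallySingular Q W)
    (hW4 : Module.finrank K W = 4) :
    ∃ φ : V ≃ₗ[K] (Fin 4 → K) × (Fin 4 → K), ∀ v, Q v = hyperbolicNorm (φ v) := by
  have : FiniteDimensional K V := Module.finite_of_finrank_pos (by omega)
  let bW : Module.Basis (Fin 4) K W := Module.finBasisOfFinrankEq K W hW4
  let e : Fin 4 → V := fun i => bW i
  have he : LinearIndependent K e := bW.linearIndependent.map' W.subtype W.ker_subtype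
  have hQe : ∀ i, Q (e i) = 0 := fun i => hW _ (bW i).2
  have hee : ∀ i j, QuadraticMap.polar Q (e i) (e j) = 0 := fun i j => by
    simp [QuadraticMap.polar, hQe, hW _ (W.add_mem (bW i).2 (bW j).2), e]
  obtain ⟨f', hf'⟩ := exists_dual_family hQ he
  -- A triangular correction makes the dual vectors singular and mutually perpendicular: the pairing
  -- of `f i` and `f j` loses `T i j + T j i`, only one of which can be nonzero, and `Q (f i)` loses
  -- `T i i`. No division by 2 occurs.
  let T : Fin 4 → Fin 4 → K := fun i j =>
    if j < i then QuadraticMap.polar Q (f' i) (f' j) else if j = i then Q (f' i) else 0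
  let f : Fin 4 → V := fun i => f' i - ∑ j, T i j • e j
  have hQs : ∀ c : Fin 4 → K, Q (∑ j, c j • e j) = 0 := fun c =>
    hW _ (W.sum_mem fun j _ => W.smul_mem _ (bW j).2)
  have hf'e : ∀ i j, QuadraticMap.polar Q (f' i) (e j) = if i = j then 1 else 0 := fun i j => by
    rw [QuadraticMap.polar_comm, hf']; simp [eq_comm]
  have hef : ∀ i j, QuadraticMap.polar Q (e i) (f j) = if i = j then 1 else 0 := by
    intro i j
    simp only [f, QuadraticMap.polar_sub_right, polar_sum_right, hf', hee]; simp
  have hfe : ∀ i j, QuadraticMap.polar Q (f i) (e j) = if i = j then 1 else 0 := fun i j => by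
    rw [QuadraticMap.polar_comm, hef]; simp [eq_comm]
  have hQf : ∀ i, Q (f i) = 0 := by
    intro i
    have := QuadraticMap.map_add Q (f i) (∑ j, T i j • e j)
    rw [polar_sum_right, hQs, sub_add_cancel] at this
    simp only [hfe] at this
    simpa [T] using this
  have hff : ∀ i j, i ≠ j → QuadraticMap.polar Q (f i) (f j) = 0 := by
    intro i j hij
    have h1 : QuadraticMap.polar Q (f i) (f j) =
        QuadraticMap.polar Q (f' i) (f' j) - T j i - T i j := by
      calc QuadraticMap.polar Q (f i) (f j) =
          QuadraticMap.polar Q (f i) (f' j - ∑ k, T j k • e k) := rfl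
        _ = QuadraticMap.polar Q (f' i - ∑ k, T i k • e k) (f' j) - T j i := by
          rw [QuadraticMap.polar_sub_right, polar_sum_right]; simp [hfe, f]
        _ = _ := by
          rw [QuadraticMap.polar_sub_left, polar_sum_left]; simp [hf']; ring
    rw [h1]
    rcases lt_or_gt_of_ne hij with h | h
    · simp [T, h, h.not_gt, h.ne', QuadraticMap.polar_comm Q (f' j)]
    · simp [T, h, h.not_gt, h.ne']
  let ψ : (Fin 4 → K) × (Fin 4 → K) →ₗ[K] V :=
    (Fintype.linearCombination K e).coprod (Fintype.linearCombination K f)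
  have hψ : ∀ x, ψ x = ∑ j, x.1 j • e j + ∑ j, x.2 j • f j := fun x => by
    simp [ψ, Fintype.linearCombination_apply]
  have hcoord1 : ∀ x i, QuadraticMap.polar Q (e i) (ψ x) = x.2 i := by
    intro x i
    rw [hψ, QuadraticMap.polar_add_right, polar_sum_right, polar_sum_right]
    simp [hee, hef]
  have hQψ : ∀ x, Q (ψ x) = hyperbolicNorm x := by
    intro x
    rw [hψ, QuadraticMap.map_add Q, hQs, map_sum_smul_eq_zero _ _ hQf hff, polar_sum_right]
    simp only [polar_sum_left, hef]
    simp [hyperbolicNorm, mul_comm]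
  have hinj : Function.Injective ψ := by
    rw [← LinearMap.ker_eq_bot, LinearMap.ker_eq_bot']
    intro x hx
    have h2 : x.2 = 0 := funext fun i => by rw [← hcoord1, hx]; simp
    have h3 := hψ x
    rw [hx, h2] at h3
    have h1 : x.1 = 0 := funext fun i =>
      Fintype.linearIndependent_iff.1 he x.1 (by simpa using h3.symm) i
    exact Prod.ext h1 h2
  let φ := LinearEquiv.ofInjectiveOfFinrankEq ψ hinj (by simp [h8])
  exact ⟨φ.symm, fun v => by rw [← hQψ]; exact congrArg Q (φ.apply_symm_apply v).symm⟩

/-- Every nondegenerate quadratic space of dimension 8 with a totally singular 4-space has a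
symmetric composition. -/
theorem exists_isSymmetricComposition {Q : QuadraticForm K V}
    {φ : V ≃ₗ[K] (Fin 4 → K) × (Fin 4 → K)} (hφ : ∀ v, Q v = hyperbolicNorm (φ v)) :
    ∃ m : V →ₗ[K] V →ₗ[K] V, IsSymmetricComposition Q m := by
  let m : V →ₗ[K] V →ₗ[K] V := ((paraZorn K).compl₁₂ φ.toLinearMap φ.toLinearMap).compr₂
    φ.symm.toLinearMap
  have hm : ∀ x y, φ (m x y) = paraZorn K (φ x) (φ y) := fun x y => by simp [m]
  have hp : ∀ x y, QuadraticMap.polar Q x y = QuadraticMap.polar hyperbolicNorm (φ x) (φ y) := by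
    intro x y; simp [QuadraticMap.polar, hφ]
  refine ⟨m, ⟨fun x y => φ.injective ?_, fun x y => φ.injective ?_, fun x y z => ?_, fun x y => ?_⟩⟩
  · rw [hm, hm, paraZorn_left, map_smul, hφ]
  · rw [hm, hm, paraZorn_right, map_smul, hφ]
  · rw [hp, hp, hm, hm, paraZorn_assoc]
  · rw [hφ, hφ, hφ, hm, hyperbolicNorm_paraZorn]

end HyperbolicCoordinates

/-! ### The 4-spaces x * V and V * x and their intersections -/

section SolidSubspaces

variable {K V : Type*} [Field K] [AddCommGroup V] [Module K V]

theorem finrank_map_add_finrank_inf_ker {V' : Type*} [AddCommGroup V'] [Module K V']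
    (f : V →ₗ[K] V') (W : Submodule K V) [FiniteDimensional K W] :
    Module.finrank K (W.map f) + Module.finrank K ↥(W ⊓ LinearMap.ker f) = Module.finrank K W := by
  have h := LinearMap.finrank_range_add_finrank_ker (f.domRestrict W)
  rw [LinearMap.range_domRestrict] at h
  have h2 : (LinearMap.ker (f.domRestrict W)).map W.subtype = W ⊓ LinearMap.ker f := by
    ext v; simp [and_comm]
  rw [← h2, Submodule.finrank_map_subtype_eq]
  exact h

theorem IsTotallySingular.mono {Q : QuadraticForm K V} {W W' : Submodule K V}
    (h : IsTotallySingular Q W') (hW : W ≤ W') : IsTotallySingular Q W :=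
  fun w hw => h w (hW hw)

theorem IsTotallySingular.polar_eq_zero {Q : QuadraticForm K V} {W : Submodule K V}
    (h : IsTotallySingular Q W) {v w : V} (hv : v ∈ W) (hw : w ∈ W) :
    QuadraticMap.polar Q v w = 0 := by
  simp [QuadraticMap.polar, h _ hv, h _ hw, h _ (W.add_mem hv hw)]

theorem eq_zero_of_polar_eq_zero {Q : QuadraticForm K V} (hQ : Q.polarBilin.Nondegenerate) {v : V}
    (h : ∀ w, QuadraticMap.polar Q v w = 0) : v = 0 :=
  hQ.1 v h

theorem exists_polar_eq_one {Q : QuadraticForm K V} (hQ : Q.polarBilin.Nondegenerate) {v : V}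
    (hv : v ≠ 0) : ∃ w, QuadraticMap.polar Q v w = 1 := by
  have : ∃ w, QuadraticMap.polar Q v w ≠ 0 := by
    by_contra! h
    exact hv (eq_zero_of_polar_eq_zero hQ h)
  obtain ⟨w, hw⟩ := this
  refine ⟨(QuadraticMap.polar Q v w)⁻¹ • w, ?_⟩
  rw [QuadraticMap.polar_smul_right, smul_eq_mul, inv_mul_cancel₀ hw]

/-- The double perpendicular of a point is the point itself. -/
theorem exists_smul_of_polar_eq_zero {Q : QuadraticForm K V} (hQ : Q.polarBilin.Nondegenerate)
    {y t : V} (hy : y ≠ 0)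
    (h : ∀ v, QuadraticMap.polar Q y v = 0 → QuadraticMap.polar Q v t = 0) :
    ∃ c : K, t = c • y := by
  obtain ⟨v₁, hv₁⟩ := exists_polar_eq_one hQ hy
  refine ⟨QuadraticMap.polar Q v₁ t, ?_⟩
  rw [← sub_eq_zero]
  refine eq_zero_of_polar_eq_zero hQ fun v => ?_
  have := h (v - QuadraticMap.polar Q y v • v₁) (by
    rw [QuadraticMap.polar_sub_right, QuadraticMap.polar_smul_right, hv₁]; simp)
  rw [QuadraticMap.polar_sub_left, QuadraticMap.polar_smul_left] at this
  rw [QuadraticMap.polar_sub_left, QuadraticMap.polar_smul_left, QuadraticMap.polar_comm Q t,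
    ← this, smul_eq_mul, smul_eq_mul, mul_comm]

/-- The space `x * V` of all left multiples by `x`. The space `V * x` is the space `x * V` for the
opposite multiplication `m.flip`. -/
def leftSpace (m : V →ₗ[K] V →ₗ[K] V) (x : V) : Submodule K V :=
  LinearMap.range (m x)

theorem mem_leftSpace {m : V →ₗ[K] V →ₗ[K] V} {x u : V} :
    u ∈ leftSpace m x ↔ ∃ v, m x v = u :=
  Iff.rfl

theorem leftSpace_smul (m : V →ₗ[K] V →ₗ[K] V) {c : K} (hc : c ≠ 0) (x : V) :
    leftSpace m (c • x) = leftSpace m x := by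
  rw [leftSpace, map_smul, LinearMap.range_smul _ _ hc]; rfl

namespace IsSymmetricComposition

variable {Q : QuadraticForm K V} {m : V →ₗ[K] V →ₗ[K] V}

/-- Left-right symmetry: each result on x * V also serves for V * x. -/
theorem flip (hm : IsSymmetricComposition Q m) : IsSymmetricComposition Q m.flip where
  left x y := hm.right x y
  right x y := hm.left x y
  assoc x y z := by
    simp only [LinearMap.flip_apply]
    rw [QuadraticMap.polar_comm, QuadraticMap.polar_comm Q x, hm.assoc]
  comp x y := by simp only [LinearMap.flip_apply]; rw [hm.comp, mul_comm]

theorem left_polar (hm : IsSymmetricComposition Q m) (x z v : V) :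
    m x (m v z) + m z (m v x) = QuadraticMap.polar Q x z • v := by
  have h := hm.left (x + z) v
  have h1 := hm.left x v
  have h2 := hm.left z v
  rw [QuadraticMap.map_add Q] at h
  simp only [map_add, LinearMap.add_apply, add_smul, h1, h2] at h
  rw [← sub_eq_zero] at h ⊢
  rw [← h]; abel

theorem right_polar (hm : IsSymmetricComposition Q m) (x z v : V) :
    m (m x v) z + m (m z v) x = QuadraticMap.polar Q x z • v := by
  rw [add_comm, QuadraticMap.polar_comm, ← hm.flip.left_polar]; simp [add_comm]

/-- The main computational tool: if x * y = 0, the composite of the two left multiplications has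
rank one. Pair with w, move factors by associativity and expand (x * v) * w by the polarised
identity; the other term vanishes as x * y = 0. -/
theorem mul_mul_of_mul_eq_zero (hm : IsSymmetricComposition Q m)
    (hQ : Q.polarBilin.Nondegenerate) {x y : V} (h : m x y = 0) (v : V) :
    m y (m x v) = QuadraticMap.polar Q y v • x := by
  rw [← sub_eq_zero]
  refine eq_zero_of_polar_eq_zero hQ fun w => ?_
  have h1 : m (m x v) w = QuadraticMap.polar Q x w • v - m (m w v) x :=
    eq_sub_of_add_eq (hm.right_polar x w v)
  have h2 : QuadraticMap.polar Q y (m (m w v) x) = 0 := by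
    rw [QuadraticMap.polar_comm, hm.assoc, h, QuadraticMap.polar_zero_right]
  rw [QuadraticMap.polar_sub_left, hm.assoc, h1, QuadraticMap.polar_sub_right, h2,
    QuadraticMap.polar_smul_right, QuadraticMap.polar_smul_left, smul_eq_mul, smul_eq_mul]
  ring

theorem isTotallySingular_leftSpace (hm : IsSymmetricComposition Q m) {x : V} (hx : Q x = 0) :
    IsTotallySingular Q (leftSpace m x) := by
  rintro _ ⟨v, rfl⟩
  rw [hm.comp, hx, zero_mul]

/-- If (x, x') = 1 and x * u = 0, the polarised identity gives u = (x' * u) * x. -/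
theorem ker_eq_leftSpace_flip (hm : IsSymmetricComposition Q m)
    (hQ : Q.polarBilin.Nondegenerate) {x : V} (hx : x ≠ 0) (hQx : Q x = 0) :
    LinearMap.ker (m x) = leftSpace m.flip x := by
  ext u
  rw [LinearMap.mem_ker, mem_leftSpace]
  constructor
  · intro h
    obtain ⟨x', hx'⟩ := exists_polar_eq_one hQ hx
    refine ⟨m x' u, ?_⟩
    have := hm.right_polar x x' u
    rw [h, hx'] at this
    simpa using this
  · rintro ⟨v, rfl⟩
    rw [LinearMap.flip_apply, hm.left, hQx, zero_smul]

theorem mul_eq_zero_iff_mem (hm : IsSymmetricComposition Q m)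
    (hQ : Q.polarBilin.Nondegenerate) {x u : V} (hx : x ≠ 0) (hQx : Q x = 0) :
    m x u = 0 ↔ u ∈ leftSpace m.flip x := by
  rw [← hm.ker_eq_leftSpace_flip hQ hx hQx, LinearMap.mem_ker]

theorem mul_eq_zero_iff_mem' (hm : IsSymmetricComposition Q m)
    (hQ : Q.polarBilin.Nondegenerate) {x u : V} (hx : x ≠ 0) (hQx : Q x = 0) :
    m u x = 0 ↔ u ∈ leftSpace m x :=
  hm.flip.mul_eq_zero_iff_mem hQ hx hQx

theorem eq_zero_right_of_mul_eq_zero (hm : IsSymmetricComposition Q m) {x v : V} (hx : x ≠ 0)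
    (h : m x v = 0) : Q v = 0 := by
  have := hm.left v x
  rw [h, map_zero] at this
  exact (smul_eq_zero.1 this.symm).resolve_right hx

theorem polar_mul_mul_self (hm : IsSymmetricComposition Q m) {x y : V}
    (hxy : QuadraticMap.polar Q x y = 0) (z : V) :
    QuadraticMap.polar Q (m x z) (m y z) = 0 := by
  rw [QuadraticMap.polar, ← LinearMap.add_apply, ← map_add, hm.comp, hm.comp, hm.comp,
    ← sub_mul, ← sub_mul]
  change QuadraticMap.polar Q x y * Q z = 0
  rw [hxy, zero_mul]

/-- For perpendicular x, y the form (z, w) ↦ (x * z, y * w) is alternating; this is what keeps the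
intersection of x * V and y * V from having dimension 3. -/
theorem polar_mul_mul_eq_neg (hm : IsSymmetricComposition Q m) {x y : V}
    (hxy : QuadraticMap.polar Q x y = 0) (z w : V) :
    QuadraticMap.polar Q (m x z) (m y w) = -QuadraticMap.polar Q (m x w) (m y z) := by
  have h0 := hm.polar_mul_mul_self hxy
  have h := h0 (z + w)
  simp only [map_add, QuadraticMap.polar_add_left, QuadraticMap.polar_add_right, h0] at h
  linear_combination h

end IsSymmetricComposition

namespace IsOPlus8

variable {Q : QuadraticForm K V} {m : V →ₗ[K] V →ₗ[K] V}

theorem finiteDimensional (hQ : IsOPlus8 Q) : FiniteDimensional K V :=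
  Module.finite_of_finrank_pos (by rw [hQ.finrank_eq]; norm_num)

theorem finrank_le_four (hQ : IsOPlus8 Q) {W : Submodule K V} (hW : IsTotallySingular Q W) :
    Module.finrank K W ≤ 4 :=
  hQ.wittIndex.2 ⟨W, hW, rfl⟩

/-- Image x * V and kernel V * x are both totally singular, hence of dimension at most 4, and their
dimensions add up to 8. -/
theorem finrank_leftSpace (hQ : IsOPlus8 Q) (hm : IsSymmetricComposition Q m) {x : V}
    (hx : x ≠ 0) (hQx : Q x = 0) : Module.finrank K (leftSpace m x) = 4 := by
  have := hQ.finiteDimensional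
  have h := LinearMap.finrank_range_add_finrank_ker (m x)
  rw [hm.ker_eq_leftSpace_flip hQ.nondegenerate hx hQx, hQ.finrank_eq] at h
  have h1 := hQ.finrank_le_four (hm.isTotallySingular_leftSpace hQx)
  have h2 := hQ.finrank_le_four (hm.flip.isTotallySingular_leftSpace hQx)
  change Module.finrank K (leftSpace m x) + _ = 8 at h
  omega

theorem leftSpace_inf_eq_bot (hQ : IsOPlus8 Q) (hm : IsSymmetricComposition Q m) {x y : V}
    (hx : x ≠ 0) (hQx : Q x = 0) (hy : y ≠ 0) (hQy : Q y = 0)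
    (hxy : QuadraticMap.polar Q x y ≠ 0) : leftSpace m x ⊓ leftSpace m y = ⊥ := by
  rw [Submodule.eq_bot_iff]
  rintro u ⟨h1, h2⟩
  rw [SetLike.mem_coe, ← hm.mul_eq_zero_iff_mem' hQ.nondegenerate hx hQx] at h1
  rw [SetLike.mem_coe, ← hm.mul_eq_zero_iff_mem' hQ.nondegenerate hy hQy] at h2
  have := hm.left_polar x y u
  rw [h1, h2, map_zero, map_zero, add_zero] at this
  exact (smul_eq_zero.1 this.symm).resolve_left hxy

/-- If the intersection were a hyperplane of x * V, the alternating form (x * z, y * w) would have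
rank at most 1, hence vanish. Then (x * z) * y = 0 for the chosen z outside, which puts x * z in y *
V. -/
theorem finrank_leftSpace_inf_ne_three (hQ : IsOPlus8 Q) (hm : IsSymmetricComposition Q m)
    {x y : V} (hx : x ≠ 0) (hQx : Q x = 0) (hy : y ≠ 0) (hQy : Q y = 0) :
    Module.finrank K ↥(leftSpace m x ⊓ leftSpace m y) ≠ 3 := by
  have := hQ.finiteDimensional
  intro h3
  by_cases hxy : QuadraticMap.polar Q x y = 0
  swap
  · rw [hQ.leftSpace_inf_eq_bot hm hx hQx hy hQy hxy] at h3; simp at h3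
  have hx4 := hQ.finrank_leftSpace hm hx hQx
  have hlt : leftSpace m x ⊓ leftSpace m y < leftSpace m x :=
    lt_of_le_of_ne inf_le_left fun h => by rw [h] at h3; omega
  obtain ⟨_, ⟨z₀, rfl⟩, hz₀⟩ := SetLike.exists_of_lt hlt
  have hz₀y : m x z₀ ∉ leftSpace m y := fun h => hz₀ ⟨⟨z₀, rfl⟩, h⟩
  have hspan : leftSpace m x ⊓ leftSpace m y ⊔ K ∙ m x z₀ = leftSpace m x := by
    apply Submodule.eq_of_le_of_finrank_le
    · rw [sup_le_iff, Submodule.span_singleton_le_iff_mem]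
      exact ⟨inf_le_left, ⟨z₀, rfl⟩⟩
    · rw [hx4]
      have : leftSpace m x ⊓ leftSpace m y < leftSpace m x ⊓ leftSpace m y ⊔ K ∙ m x z₀ :=
        lt_of_le_of_ne le_sup_left fun h => hz₀ (h ▸
          Submodule.mem_sup_right (Submodule.mem_span_singleton_self _))
      have := Submodule.finrank_lt_finrank_of_lt this
      omega
  have hform : ∀ z, ∃ c : K, ∀ w,
      QuadraticMap.polar Q (m x z) (m y w) = c * QuadraticMap.polar Q (m x z₀) (m y w) := by
    intro z
    have : m x z ∈ leftSpace m x ⊓ leftSpace m y ⊔ K ∙ m x z₀ := hspan.symm ▸ ⟨z, rfl⟩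
    obtain ⟨s, hs, t, ht, hst⟩ := Submodule.mem_sup.1 this
    obtain ⟨c, rfl⟩ := Submodule.mem_span_singleton.1 ht
    refine ⟨c, fun w => ?_⟩
    rw [← hst, QuadraticMap.polar_add_left, QuadraticMap.polar_smul_left,
      (hm.isTotallySingular_leftSpace hQy).polar_eq_zero hs.2 ⟨w, rfl⟩, zero_add, smul_eq_mul]
  have hzero : ∀ w, QuadraticMap.polar Q (m x z₀) (m y w) = 0 := by
    intro w
    obtain ⟨c, hc⟩ := hform w
    rw [hm.polar_mul_mul_eq_neg hxy, hc, hm.polar_mul_mul_self hxy, mul_zero, neg_zero]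
  apply hz₀y
  rw [← hm.mul_eq_zero_iff_mem' hQ.nondegenerate hy hQy]
  refine eq_zero_of_polar_eq_zero hQ.nondegenerate fun w => ?_
  rw [hm.assoc, hzero]

/-- As x * (v * y) = -y * (v * x), left multiplication by x maps the 4-space V * y into x * V ∩ y *
V, with kernel V * x ∩ V * y. -/
theorem four_le_finrank_inf_add_finrank_inf (hQ : IsOPlus8 Q) (hm : IsSymmetricComposition Q m)
    {x y : V} (hx : x ≠ 0) (hQx : Q x = 0) (hy : y ≠ 0) (hQy : Q y = 0)
    (hxy : QuadraticMap.polar Q x y = 0) :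
    4 ≤ Module.finrank K ↥(leftSpace m x ⊓ leftSpace m y) +
      Module.finrank K ↥(leftSpace m.flip x ⊓ leftSpace m.flip y) := by
  have := hQ.finiteDimensional
  have h := finrank_map_add_finrank_inf_ker (m x) (leftSpace m.flip y)
  rw [hQ.finrank_leftSpace hm.flip hy hQy, hm.ker_eq_leftSpace_flip hQ.nondegenerate hx hQx,
    inf_comm] at h
  have hle : (leftSpace m.flip y).map (m x) ≤ leftSpace m x ⊓ leftSpace m y := by
    rintro _ ⟨_, ⟨v, rfl⟩, rfl⟩
    refine ⟨⟨_, rfl⟩, ⟨-m v x, ?_⟩⟩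
    have := hm.left_polar x y v
    rw [hxy, zero_smul] at this
    rw [map_neg, LinearMap.flip_apply]
    exact (eq_neg_of_add_eq_zero_left this).symm
  have := Submodule.finrank_mono hle
  omega

/-- If V * x and V * y had zero intersection they would span V, and for z ≠ 0 in x * V = y * V the
rank-one identity would put the 4-space V * z inside ⟨x, y⟩. Otherwise a common z ≠ 0 has x * z = y
* z = 0, and evaluating z * (x * v) = z * (y * v') in two ways exhibits x as a multiple of y. -/
theorem exists_smul_of_leftSpace_eq (hQ : IsOPlus8 Q) (hm : IsSymmetricComposition Q m)
    {x y : V} (hx : x ≠ 0) (hQx : Q x = 0) (hy : y ≠ 0) (hQy : Q y = 0)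
    (hxy : leftSpace m x = leftSpace m y) : ∃ c : K, x = c • y := by
  have := hQ.finiteDimensional
  have hnd := hQ.nondegenerate
  by_cases hbot : leftSpace m.flip x ⊓ leftSpace m.flip y = ⊥
  · exfalso
    have hx4 := hQ.finrank_leftSpace hm hx hQx
    have htop : leftSpace m.flip x ⊔ leftSpace m.flip y = ⊤ := by
      apply Submodule.eq_top_of_finrank_eq
      have := Submodule.finrank_sup_add_finrank_inf_eq (leftSpace m.flip x) (leftSpace m.flip y)
      rw [hbot, hQ.finrank_leftSpace hm.flip hx hQx, hQ.finrank_leftSpace hm.flip hy hQy,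
        finrank_bot] at this
      rw [hQ.finrank_eq]; exact this
    obtain ⟨z, hz, hz0⟩ := Submodule.exists_mem_ne_zero_of_ne_bot
      (p := leftSpace m x) (by rintro h; rw [h, finrank_bot] at hx4; omega)
    have hQz := hm.isTotallySingular_leftSpace hQx z hz
    have hzx := (hm.mul_eq_zero_iff_mem' hnd hx hQx).2 hz
    have hzy := (hm.mul_eq_zero_iff_mem' hnd hy hQy).2 (hxy ▸ hz)
    have hle : leftSpace m.flip z ≤ (K ∙ x) ⊔ (K ∙ y) := by
      rintro _ ⟨v, rfl⟩
      have hv : v ∈ leftSpace m.flip x ⊔ leftSpace m.flip y := htop ▸ Submodule.mem_top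
      obtain ⟨_, ⟨a, rfl⟩, _, ⟨b, rfl⟩, rfl⟩ := Submodule.mem_sup.1 hv
      rw [map_add, hm.flip.mul_mul_of_mul_eq_zero hnd hzx, hm.flip.mul_mul_of_mul_eq_zero hnd hzy]
      exact Submodule.add_mem_sup (Submodule.smul_mem _ _ (Submodule.mem_span_singleton_self _))
        (Submodule.smul_mem _ _ (Submodule.mem_span_singleton_self _))
    have h1 := Submodule.finrank_mono hle
    rw [hQ.finrank_leftSpace hm.flip hz0 hQz] at h1
    have h2 := Submodule.finrank_add_le_finrank_add_finrank (K ∙ x) (K ∙ y)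
    rw [finrank_span_singleton hx, finrank_span_singleton hy] at h2
    omega
  · obtain ⟨z, ⟨hz1, hz2⟩, hz0⟩ := Submodule.exists_mem_ne_zero_of_ne_bot hbot
    have hxz := (hm.mul_eq_zero_iff_mem hnd hx hQx).2 hz1
    have hyz := (hm.mul_eq_zero_iff_mem hnd hy hQy).2 hz2
    obtain ⟨v, hv⟩ := exists_polar_eq_one hnd hz0
    obtain ⟨v', hv'⟩ : m x v ∈ leftSpace m y := hxy ▸ ⟨v, rfl⟩
    refine ⟨QuadraticMap.polar Q z v', ?_⟩
    rw [← hm.mul_mul_of_mul_eq_zero hnd hyz, hv', hm.mul_mul_of_mul_eq_zero hnd hxz, hv, one_smul]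

/-- The left and right intersections have dimension at most 2, since 3 and 4 are excluded, and their
sum is at least 4. -/
theorem finrank_leftSpace_inf_eq_two (hQ : IsOPlus8 Q) (hm : IsSymmetricComposition Q m)
    {x y : V} (hQx : Q x = 0) (hy : y ≠ 0) (hQy : Q y = 0)
    (hxy : QuadraticMap.polar Q x y = 0) (hind : ∀ c : K, x ≠ c • y) :
    Module.finrank K ↥(leftSpace m x ⊓ leftSpace m y) = 2 := by
  have := hQ.finiteDimensional
  have hx : x ≠ 0 := by rintro rfl; exact hind 0 (by simp)
  have key : ∀ m : V →ₗ[K] V →ₗ[K] V, IsSymmetricComposition Q m →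
      Module.finrank K ↥(leftSpace m x ⊓ leftSpace m y) ≤ 2 := by
    intro m hm
    have hx4 := hQ.finrank_leftSpace hm hx hQx
    have hy4 := hQ.finrank_leftSpace hm hy hQy
    have h3 := hQ.finrank_leftSpace_inf_ne_three hm hx hQx hy hQy
    have hle := Submodule.finrank_mono (inf_le_left : leftSpace m x ⊓ leftSpace m y ≤ _)
    have h4 : Module.finrank K ↥(leftSpace m x ⊓ leftSpace m y) ≠ 4 := by
      intro h4
      have e1 := Submodule.eq_of_le_of_finrank_eq
        (inf_le_left : leftSpace m x ⊓ leftSpace m y ≤ _) (by omega)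
      have e2 := Submodule.eq_of_le_of_finrank_eq
        (inf_le_right : leftSpace m x ⊓ leftSpace m y ≤ _) (by omega)
      obtain ⟨c, hc⟩ := hQ.exists_smul_of_leftSpace_eq hm hx hQx hy hQy (e1.symm.trans e2)
      exact hind c hc
    omega
  have h1 := key m hm
  have h2 := key _ hm.flip
  have := hQ.four_le_finrank_inf_add_finrank_inf hm hx hQx hy hQy hxy
  omega

theorem even_finrank_leftSpace_inf (hQ : IsOPlus8 Q) (hm : IsSymmetricComposition Q m)
    {x y : V} (hx : x ≠ 0) (hQx : Q x = 0) (hy : y ≠ 0) (hQy : Q y = 0) :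
    Even (Module.finrank K ↥(leftSpace m x ⊓ leftSpace m y)) := by
  by_cases hxy : QuadraticMap.polar Q x y = 0
  · by_cases hc : ∃ c : K, x = c • y
    · obtain ⟨c, rfl⟩ := hc
      have hc : c ≠ 0 := by rintro rfl; simp at hx
      rw [leftSpace_smul m hc, inf_idem, hQ.finrank_leftSpace hm hy hQy]
      decide
    · push Not at hc
      rw [hQ.finrank_leftSpace_inf_eq_two hm hQx hy hQy hxy hc]
      decide
  · rw [hQ.leftSpace_inf_eq_bot hm hx hQx hy hQy hxy]; simp

theorem exists_smul_of_three_le_finrank_inf (hQ : IsOPlus8 Q) (hm : IsSymmetricComposition Q m)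
    {x y : V} (hx : x ≠ 0) (hQx : Q x = 0) (hy : y ≠ 0) (hQy : Q y = 0)
    (h : 3 ≤ Module.finrank K ↥(leftSpace m x ⊓ leftSpace m y)) : ∃ c : K, x = c • y := by
  by_contra! hc
  by_cases hxy : QuadraticMap.polar Q x y = 0
  · rw [hQ.finrank_leftSpace_inf_eq_two hm hQx hy hQy hxy hc] at h; omega
  · rw [hQ.leftSpace_inf_eq_bot hm hx hQx hy hQy hxy] at h; simp at h

/-- The intersection is the kernel of left multiplication by y on x * V, whose image is ⟨x⟩ by the
rank-one identity. -/
theorem finrank_inf_flip_eq_three (hQ : IsOPlus8 Q) (hm : IsSymmetricComposition Q m)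
    {x y : V} (hx : x ≠ 0) (hQx : Q x = 0) (hy : y ≠ 0) (hQy : Q y = 0) (hxy : m x y = 0) :
    Module.finrank K ↥(leftSpace m x ⊓ leftSpace m.flip y) = 3 := by
  have := hQ.finiteDimensional
  have h := finrank_map_add_finrank_inf_ker (m y) (leftSpace m x)
  rw [hm.ker_eq_leftSpace_flip hQ.nondegenerate hy hQy, hQ.finrank_leftSpace hm hx hQx] at h
  have : (leftSpace m x).map (m y) = K ∙ x := by
    apply le_antisymm
    · rintro _ ⟨_, ⟨v, rfl⟩, rfl⟩
      rw [hm.mul_mul_of_mul_eq_zero hQ.nondegenerate hxy]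
      exact Submodule.smul_mem _ _ (Submodule.mem_span_singleton_self x)
    · rw [Submodule.span_singleton_le_iff_mem]
      obtain ⟨v, hv⟩ := exists_polar_eq_one hQ.nondegenerate hy
      exact ⟨m x v, ⟨v, rfl⟩, by rw [hm.mul_mul_of_mul_eq_zero hQ.nondegenerate hxy, hv, one_smul]⟩
  rw [this, finrank_span_singleton hx] at h
  omega

/-- Take y representing a nonzero functional that vanishes on the preimage of `W` under left
multiplication by x. That preimage contains the kernel, so x * y = 0, and then y * (x * v) = (y, v)
x vanishes whenever x * v lies in `W`. -/
theorem exists_le_flip_of_le_leftSpace (hQ : IsOPlus8 Q) (hm : IsSymmetricComposition Q m)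
    {x : V} (hx : x ≠ 0) (hQx : Q x = 0) {W : Submodule K V} (hW : Module.finrank K W = 3)
    (hWx : W ≤ leftSpace m x) :
    ∃ y, y ≠ 0 ∧ Q y = 0 ∧ m x y = 0 ∧ W ≤ leftSpace m.flip y := by
  have := hQ.finiteDimensional
  have hlt : W.comap (m x) < ⊤ := by
    rw [lt_top_iff_ne_top]
    intro h
    have : leftSpace m x ≤ W := by
      rintro _ ⟨v, rfl⟩
      exact (h ▸ Submodule.mem_top : v ∈ W.comap (m x))
    have := Submodule.finrank_mono this
    rw [hQ.finrank_leftSpace hm hx hQx] at this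
    omega
  obtain ⟨g, hg0, hg⟩ := Submodule.exists_le_ker_of_lt_top _ hlt
  let y := (LinearMap.BilinForm.toDual Q.polarBilin hQ.nondegenerate).symm g
  have hyg : ∀ v, QuadraticMap.polar Q y v = g v := fun v =>
    LinearMap.BilinForm.apply_toDual_symm_apply (hB := hQ.nondegenerate) g v
  have hy : y ≠ 0 := by
    intro h
    apply hg0
    ext v
    rw [← hyg, h, QuadraticMap.polar_zero_left, LinearMap.zero_apply]
  have hxy : m x y = 0 := by
    refine eq_zero_of_polar_eq_zero hQ.nondegenerate fun z => ?_
    rw [QuadraticMap.polar_comm, ← hm.assoc, QuadraticMap.polar_comm, hyg]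
    apply hg
    rw [Submodule.mem_comap, hm.left, hQx, zero_smul]
    exact W.zero_mem
  have hQy := hm.eq_zero_right_of_mul_eq_zero hx hxy
  refine ⟨y, hy, hQy, hxy, fun w hw => ?_⟩
  obtain ⟨v, rfl⟩ := hWx hw
  rw [← hm.mul_eq_zero_iff_mem hQ.nondegenerate hy hQy,
    hm.mul_mul_of_mul_eq_zero hQ.nondegenerate hxy, hyg, hg hw, zero_smul]

theorem finrank_inf_flip_eq_three_iff (hQ : IsOPlus8 Q) (hm : IsSymmetricComposition Q m)
    {x y : V} (hx : x ≠ 0) (hQx : Q x = 0) (hy : y ≠ 0) (hQy : Q y = 0) :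
    Module.finrank K ↥(leftSpace m x ⊓ leftSpace m.flip y) = 3 ↔ m x y = 0 := by
  have := hQ.finiteDimensional
  refine ⟨fun h => ?_, hQ.finrank_inf_flip_eq_three hm hx hQx hy hQy⟩
  obtain ⟨y', hy', hQy', hxy', hle⟩ := hQ.exists_le_flip_of_le_leftSpace hm hx hQx h inf_le_left
  have h3 := Submodule.finrank_mono (le_inf inf_le_right hle :
    leftSpace m x ⊓ leftSpace m.flip y ≤ leftSpace m.flip y ⊓ leftSpace m.flip y')
  rw [h] at h3
  obtain ⟨c, rfl⟩ := hQ.exists_smul_of_three_le_finrank_inf hm.flip hy hQy hy' hQy' h3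
  rw [map_smul, hxy', smul_zero]

theorem leftSpace_ne_flip (hQ : IsOPlus8 Q) (hm : IsSymmetricComposition Q m)
    {x y : V} (hx : x ≠ 0) (hQx : Q x = 0) (hy : y ≠ 0) (hQy : Q y = 0) :
    leftSpace m x ≠ leftSpace m.flip y := by
  intro h
  have hx4 := hQ.finrank_leftSpace hm.flip hx hQx
  obtain ⟨z, hz, hz0⟩ := Submodule.exists_mem_ne_zero_of_ne_bot
    (p := leftSpace m.flip x) (by rintro h; rw [h, finrank_bot] at hx4; omega)
  have hQz := hm.flip.isTotallySingular_leftSpace hQx z hz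
  have h3 := hQ.finrank_inf_flip_eq_three hm hx hQx hz0 hQz
    ((hm.mul_eq_zero_iff_mem hQ.nondegenerate hx hQx).2 hz)
  rw [h] at h3
  exact hQ.finrank_leftSpace_inf_ne_three hm.flip hy hQy hz0 hQz h3

end IsOPlus8

end SolidSubspaces

/-! ### Classification of totally singular 4-spaces and the triality -/

section TrialityMap

variable {K V : Type*} [Field K] [AddCommGroup V] [Module K V]

theorem exists_le_finrank_eq {W : Submodule K V} {n k : ℕ} (hW : Module.finrank K W = n)
    (hn : n ≠ 0) (hk : k ≤ n) : ∃ W' ≤ W, Module.finrank K W' = k := by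
  have : FiniteDimensional K W := Module.finite_of_finrank_pos (by omega)
  let b := Module.finBasisOfFinrankEq K W hW
  have hb : LinearIndependent K (fun i : Fin k => (b (Fin.castLE hk i) : V)) :=
    (b.linearIndependent.map' W.subtype W.ker_subtype).comp _ (Fin.castLE_injective hk)
  refine ⟨Submodule.span K (Set.range fun i : Fin k => (b (Fin.castLE hk i) : V)), ?_, ?_⟩
  · rw [Submodule.span_le]
    rintro _ ⟨i, rfl⟩
    exact (b _).2
  · rw [finrank_span_eq_card hb, Fintype.card_fin]

namespace IsOPlus8

variable {Q : QuadraticForm K V} {m : V →ₗ[K] V →ₗ[K] V}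

/-- For a basis w₀, w₁, w₂ of `W`, a common right or left annihilator is sought. Left multiplication
by w₂ maps the 2-space `D` of right annihilators of w₀, w₁ to the 2-space `D'` of their left
annihilators. A kernel vector annihilates all three on the right; if there is none, `D'` lies in w₂
* V and annihilates all three on the left. -/
theorem exists_le_leftSpace_or_le_flip (hQ : IsOPlus8 Q) (hm : IsSymmetricComposition Q m)
    {W : Submodule K V} (hW : IsTotallySingular Q W) (hW3 : Module.finrank K W = 3) :
    ∃ x, x ≠ 0 ∧ Q x = 0 ∧ (W ≤ leftSpace m x ∨ W ≤ leftSpace m.flip x) := by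
  have := hQ.finiteDimensional
  have hnd := hQ.nondegenerate
  let b := Module.finBasisOfFinrankEq K W hW3
  let w : Fin 3 → V := fun i => b i
  have hw0 : ∀ i, w i ≠ 0 := fun i h => b.ne_zero i (Subtype.ext h)
  have hwQ : ∀ i, Q (w i) = 0 := fun i => hW _ (b i).2
  have hww : ∀ i j, QuadraticMap.polar Q (w i) (w j) = 0 := fun i j =>
    hW.polar_eq_zero (b i).2 (b j).2
  have hind : ∀ c : K, w 0 ≠ c • w 1 := by
    intro c h
    have h' : b 0 = c • b 1 := Subtype.ext h
    have := congrArg (fun v => b.repr v 0) h'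
    simp at this
  have hle : ∀ S : Submodule K V, (∀ i, w i ∈ S) → W ≤ S := by
    intro S hS v hv
    have := congrArg Subtype.val (b.sum_repr ⟨v, hv⟩)
    rw [← show _ = v from this, AddSubmonoidClass.coe_finsetSum]
    exact S.sum_mem fun i _ => S.smul_mem _ (hS i)
  let D := leftSpace m.flip (w 0) ⊓ leftSpace m.flip (w 1)
  let D' := leftSpace m (w 0) ⊓ leftSpace m (w 1)
  have hD : Module.finrank K D = 2 :=
    hQ.finrank_leftSpace_inf_eq_two hm.flip (hwQ 0) (hw0 1) (hwQ 1) (hww 0 1) hind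
  have hD' : Module.finrank K D' = 2 :=
    hQ.finrank_leftSpace_inf_eq_two hm (hwQ 0) (hw0 1) (hwQ 1) (hww 0 1) hind
  have hmap : D.map (m (w 2)) ≤ D' := by
    have key : ∀ i z, m (w 2) (m z (w i)) ∈ leftSpace m (w i) := by
      intro i z
      have := hm.left_polar (w 2) (w i) z
      rw [hww, zero_smul] at this
      exact ⟨-m z (w 2), by rw [map_neg]; exact (eq_neg_of_add_eq_zero_left this).symm⟩
    rintro _ ⟨v, ⟨⟨z, hz⟩, ⟨z', hz'⟩⟩, rfl⟩
    constructor
    · rw [← hz]; exact key 0 z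
    · rw [← hz']; exact key 1 z'
  have h := finrank_map_add_finrank_inf_ker (m (w 2)) D
  by_cases hbot : D ⊓ LinearMap.ker (m (w 2)) = ⊥
  · rw [hbot, finrank_bot, hD] at h
    have hD'le : D' ≤ leftSpace m (w 2) := by
      rw [← Submodule.eq_of_le_of_finrank_eq hmap (by omega)]
      rintro _ ⟨v, -, rfl⟩
      exact ⟨v, rfl⟩
    obtain ⟨x, hx, hx0⟩ := Submodule.exists_mem_ne_zero_of_ne_bot
      (p := D') (by rintro h; rw [h, finrank_bot] at hD'; omega)
    have hQx := hm.isTotallySingular_leftSpace (hwQ 0) x hx.1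
    refine ⟨x, hx0, hQx, Or.inr (hle _ fun i => ?_)⟩
    rw [← hm.mul_eq_zero_iff_mem hnd hx0 hQx, hm.mul_eq_zero_iff_mem' hnd (hw0 i) (hwQ i)]
    fin_cases i
    · exact hx.1
    · exact hx.2
    · exact hD'le hx
  · obtain ⟨x, ⟨hx, hx2⟩, hx0⟩ := Submodule.exists_mem_ne_zero_of_ne_bot hbot
    have hQx := hm.flip.isTotallySingular_leftSpace (hwQ 0) x hx.1
    refine ⟨x, hx0, hQx, Or.inl (hle _ fun i => ?_)⟩
    rw [← hm.mul_eq_zero_iff_mem' hnd hx0 hQx]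
    fin_cases i
    · exact (hm.mul_eq_zero_iff_mem hnd (hw0 0) (hwQ 0)).2 hx.1
    · exact (hm.mul_eq_zero_iff_mem hnd (hw0 1) (hwQ 1)).2 hx.2
    · exact hx2

theorem exists_le_leftSpace_le_flip (hQ : IsOPlus8 Q) (hm : IsSymmetricComposition Q m)
    {W : Submodule K V} (hW : IsTotallySingular Q W) (hW3 : Module.finrank K W = 3) :
    ∃ x y, x ≠ 0 ∧ Q x = 0 ∧ y ≠ 0 ∧ Q y = 0 ∧ m x y = 0 ∧
      W ≤ leftSpace m x ∧ W ≤ leftSpace m.flip y := by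
  obtain ⟨x, hx, hQx, hle | hle⟩ := hQ.exists_le_leftSpace_or_le_flip hm hW hW3
  · obtain ⟨y, hy, hQy, hxy, hle'⟩ := hQ.exists_le_flip_of_le_leftSpace hm hx hQx hW3 hle
    exact ⟨x, y, hx, hQx, hy, hQy, hxy, hle, hle'⟩
  · obtain ⟨y, hy, hQy, hxy, hle'⟩ := hQ.exists_le_flip_of_le_leftSpace hm.flip hx hQx hW3 hle
    exact ⟨y, x, hy, hQy, hx, hQx, hxy, hle', hle⟩

theorem exists_smul_of_polar_inf_eq_zero (hQ : IsOPlus8 Q) (hm : IsSymmetricComposition Q m)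
    {x y u : V} (hy : y ≠ 0) (hQy : Q y = 0) (hxy : m x y = 0)
    (hu : ∀ w ∈ leftSpace m x ⊓ leftSpace m.flip y, QuadraticMap.polar Q w u = 0) :
    ∃ c : K, m u x = c • y := by
  refine exists_smul_of_polar_eq_zero hQ.nondegenerate hy fun v hv => ?_
  rw [← hm.assoc, QuadraticMap.polar_comm, ← hm.assoc]
  refine hu _ ⟨⟨v, rfl⟩, ?_⟩
  rw [SetLike.mem_coe, ← hm.mul_eq_zero_iff_mem hQ.nondegenerate hy hQy,
    hm.mul_mul_of_mul_eq_zero hQ.nondegenerate hxy, hv, zero_smul]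

/-- A 3-space of `W` is x * V ∩ V * y with x * y = 0. A further vector u of `W` satisfies u * x = c
y and y * u = c' x, and (u * x) * u = Q(u) x = 0 forces c c' = 0; so u lies in x * V or in V * y. -/
theorem eq_leftSpace_or_eq_flip (hQ : IsOPlus8 Q) (hm : IsSymmetricComposition Q m)
    {W : Submodule K V} (hW : IsTotallySingular Q W) (hW4 : Module.finrank K W = 4) :
    ∃ x, x ≠ 0 ∧ Q x = 0 ∧ (W = leftSpace m x ∨ W = leftSpace m.flip x) := by
  have := hQ.finiteDimensional
  have hnd := hQ.nondegenerate
  obtain ⟨W₀, hle, hW₀⟩ := exists_le_finrank_eq hW4 (by norm_num) (by norm_num : 3 ≤ 4)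
  obtain ⟨x, y, hx, hQx, hy, hQy, hxy, h1, h2⟩ :=
    hQ.exists_le_leftSpace_le_flip hm (hW.mono hle) hW₀
  have hW₀eq : W₀ = leftSpace m x ⊓ leftSpace m.flip y :=
    Submodule.eq_of_le_of_finrank_eq (le_inf h1 h2)
      (by rw [hW₀, hQ.finrank_inf_flip_eq_three hm hx hQx hy hQy hxy])
  have hlt : W₀ < W := lt_of_le_of_ne hle fun h => by rw [h] at hW₀; omega
  obtain ⟨u, hu, hu₀⟩ := SetLike.exists_of_lt hlt
  have hperp : ∀ w ∈ leftSpace m x ⊓ leftSpace m.flip y, QuadraticMap.polar Q w u = 0 :=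
    fun w hw => hW.polar_eq_zero (hle (hW₀eq ▸ hw)) hu
  obtain ⟨c, hc⟩ := hQ.exists_smul_of_polar_inf_eq_zero hm hy hQy hxy hperp
  obtain ⟨c', hc'⟩ := hQ.exists_smul_of_polar_inf_eq_zero hm.flip hx hQx hxy
    (fun w hw => hperp w ⟨hw.2, hw.1⟩)
  rw [LinearMap.flip_apply] at hc'
  have hcc : c * c' = 0 := by
    have := hm.right u x
    rw [hc, hW u hu, map_smul, LinearMap.smul_apply, hc', smul_smul, zero_smul] at this
    exact (smul_eq_zero.1 this).resolve_right hx
  have conclude : ∀ M : Submodule K V, Module.finrank K M = 4 → W₀ ≤ M → u ∈ M → W = M := by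
    intro M hM hle' huM
    have : W₀ < W ⊓ M := lt_of_le_of_ne (le_inf hle hle') fun h => hu₀ (h ▸ ⟨hu, huM⟩)
    have := Submodule.finrank_lt_finrank_of_lt this
    have e1 := Submodule.eq_of_le_of_finrank_le (inf_le_left : W ⊓ M ≤ W) (by omega)
    have e2 := Submodule.eq_of_le_of_finrank_le (inf_le_right : W ⊓ M ≤ M) (by omega)
    exact e1.symm.trans e2
  rcases mul_eq_zero.1 hcc with rfl | rfl
  · refine ⟨x, hx, hQx, Or.inl (conclude _ (hQ.finrank_leftSpace hm hx hQx) h1 ?_)⟩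
    rw [← hm.mul_eq_zero_iff_mem' hnd hx hQx, hc, zero_smul]
  · refine ⟨y, hy, hQy, Or.inr (conclude _ (hQ.finrank_leftSpace hm.flip hy hQy) h2 ?_)⟩
    rw [← hm.mul_eq_zero_iff_mem hnd hy hQy, hc', zero_smul]

end IsOPlus8

theorem IsSingularPoint.exists_generator {Q : QuadraticForm K V} {P : Submodule K V}
    (hP : IsSingularPoint Q P) : ∃ x, x ≠ 0 ∧ Q x = 0 ∧ P = K ∙ x := by
  obtain ⟨x, hx, hx0⟩ := Submodule.exists_mem_ne_zero_of_ne_bot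
    (p := P) (by rintro h; have := hP.2; rw [h, finrank_bot] at this; omega)
  have : FiniteDimensional K P := Module.finite_of_finrank_pos (by rw [hP.2]; norm_num)
  refine ⟨x, hx0, hP.1 x hx, (Submodule.eq_of_le_of_finrank_eq ?_ ?_).symm⟩
  · rwa [Submodule.span_singleton_le_iff_mem]
  · rw [finrank_span_singleton hx0, hP.2]

theorem isSingularPoint_span {Q : QuadraticForm K V} {x : V} (hx : x ≠ 0) (hQx : Q x = 0) :
    IsSingularPoint Q (K ∙ x) := by
  refine ⟨fun w hw => ?_, finrank_span_singleton hx⟩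
  obtain ⟨c, rfl⟩ := Submodule.mem_span_singleton.1 hw
  rw [QuadraticMap.map_smul, hQx, smul_zero]

theorem span_singleton_eq_of_eq_smul {x y : V} {c : K} (hx : x ≠ 0) (h : x = c • y) :
    (K ∙ x) = K ∙ y := by
  have hc : c ≠ 0 := by rintro rfl; simp at h; exact hx h
  rw [h, Submodule.span_singleton_smul_eq (IsUnit.mk0 c hc)]

/-- The singular points of a quadratic space, as a type. -/
def SingularPoint (Q : QuadraticForm K V) : Type _ :=
  {P : Submodule K V // IsSingularPoint Q P}

/-- A vector spanning a given singular point. -/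
noncomputable def SingularPoint.generator {Q : QuadraticForm K V} (P : SingularPoint Q) : V :=
  P.2.exists_generator.choose

namespace SingularPoint

variable {Q : QuadraticForm K V} (P : SingularPoint Q)

theorem generator_ne_zero : P.generator ≠ 0 := P.2.exists_generator.choose_spec.1

theorem map_generator : Q P.generator = 0 := P.2.exists_generator.choose_spec.2.1

theorem eq_span : P.1 = K ∙ P.generator := P.2.exists_generator.choose_spec.2.2

theorem leftSpace_generator (m : V →ₗ[K] V →ₗ[K] V) {x : V} (h : P.1 = K ∙ x) :
    leftSpace m P.generator = leftSpace m x := by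
  obtain ⟨c, hc⟩ := Submodule.mem_span_singleton.1
    (h ▸ P.eq_span ▸ Submodule.mem_span_singleton_self _ : P.generator ∈ K ∙ x)
  rw [← hc, leftSpace_smul m]
  rintro rfl
  exact P.generator_ne_zero (by rw [← hc, zero_smul])

theorem eq_of_generator_eq_smul {P P' : SingularPoint Q}
    (h : ∃ c : K, P.generator = c • P'.generator) : P = P' := by
  obtain ⟨c, hc⟩ := h
  apply Subtype.ext
  rw [P.eq_span, P'.eq_span, span_singleton_eq_of_eq_smul P.generator_ne_zero hc]

end SingularPoint

theorem incident_comm {Q : QuadraticForm K V} {X Y : Element Q} :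
    Incident Q X Y ↔ Incident Q Y X := by
  unfold Incident
  rw [inf_comm, or_left_comm]

namespace IsOPlus8

variable {Q : QuadraticForm K V} {m : V →ₗ[K] V →ₗ[K] V}

/-- The points and 4-spaces `P`, `P * V` and `V * P` associated with a singular point `P`. -/
noncomputable def toElement (hQ : IsOPlus8 Q) (hm : IsSymmetricComposition Q m) :
    SingularPoint Q × Fin 3 → Element Q
  | (P, 0) => ⟨P.1, P.2.1, Or.inl P.2.2⟩
  | (P, 1) => ⟨leftSpace m P.generator, hm.isTotallySingular_leftSpace P.map_generator,
      Or.inr (hQ.finrank_leftSpace hm P.generator_ne_zero P.map_generator)⟩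
  | (P, 2) => ⟨leftSpace m.flip P.generator, hm.flip.isTotallySingular_leftSpace P.map_generator,
      Or.inr (hQ.finrank_leftSpace hm.flip P.generator_ne_zero P.map_generator)⟩

theorem incident_point_iff (hQ : IsOPlus8 Q) {X Y : Element Q} (hX : Module.finrank K X.1 = 1)
    (hY : Module.finrank K Y.1 = 4) : Incident Q X Y ↔ X.1 ≤ Y.1 := by
  have := hQ.finiteDimensional
  refine ⟨?_, Or.inl⟩
  rintro (h | h | h)
  · exact h
  · have := Submodule.finrank_mono h; omega
  · have := Submodule.finrank_mono (inf_le_left : X.1 ⊓ Y.1 ≤ X.1); omega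

theorem incident_iff_of_finrank_eq (hQ : IsOPlus8 Q) {X Y : Element Q}
    (h : Module.finrank K X.1 = Module.finrank K Y.1) :
    Incident Q X Y ↔ X.1 = Y.1 ∨ Module.finrank K ↥(X.1 ⊓ Y.1) = 3 := by
  have := hQ.finiteDimensional
  constructor
  · rintro (h1 | h1 | h1)
    · exact Or.inl (Submodule.eq_of_le_of_finrank_eq h1 h)
    · exact Or.inl (Submodule.eq_of_le_of_finrank_eq h1 h.symm).symm
    · exact Or.inr h1
  · rintro (h1 | h1)
    · exact Or.inl h1.le
    · exact Or.inr (Or.inr h1)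

variable (hQ : IsOPlus8 Q) (hm : IsSymmetricComposition Q m)

theorem toElement_bijective : Function.Bijective (hQ.toElement hm) := by
  have hL := fun P : SingularPoint Q =>
    hQ.finrank_leftSpace hm P.generator_ne_zero P.map_generator
  have hR := fun P : SingularPoint Q =>
    hQ.finrank_leftSpace hm.flip P.generator_ne_zero P.map_generator
  have hne := fun P P' : SingularPoint Q => hQ.leftSpace_ne_flip hm P.generator_ne_zero
    P.map_generator P'.generator_ne_zero P'.map_generator
  constructor
  · rintro ⟨P, i⟩ ⟨P', j⟩ h
    have h1 := congrArg Subtype.val h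
    have hP := P.2.2
    have hP' := P'.2.2
    fin_cases i <;> fin_cases j
    · exact Prod.ext (Subtype.ext h1) rfl
    · change P.1 = leftSpace m P'.generator at h1
      rw [h1, hL] at hP; omega
    · change P.1 = leftSpace m.flip P'.generator at h1
      rw [h1, hR] at hP; omega
    · change leftSpace m P.generator = P'.1 at h1
      rw [← h1, hL] at hP'; omega
    · exact Prod.ext (SingularPoint.eq_of_generator_eq_smul (hQ.exists_smul_of_leftSpace_eq hm
        P.generator_ne_zero P.map_generator P'.generator_ne_zero P'.map_generator h1)) rfl
    · exact (hne _ _ h1).elim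
    · change leftSpace m.flip P.generator = P'.1 at h1
      rw [← h1, hR] at hP'; omega
    · exact (hne _ _ h1.symm).elim
    · exact Prod.ext (SingularPoint.eq_of_generator_eq_smul (hQ.exists_smul_of_leftSpace_eq hm.flip
        P.generator_ne_zero P.map_generator P'.generator_ne_zero P'.map_generator h1)) rfl
  · rintro ⟨W, hW, h1 | h4⟩
    · exact ⟨(⟨W, hW, h1⟩, 0), rfl⟩
    · obtain ⟨x, hx, hQx, h | h⟩ := hQ.eq_leftSpace_or_eq_flip hm hW h4
      · refine ⟨(⟨K ∙ x, isSingularPoint_span hx hQx⟩, 1), Subtype.ext ?_⟩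
        exact (SingularPoint.leftSpace_generator _ m rfl).trans h.symm
      · refine ⟨(⟨K ∙ x, isSingularPoint_span hx hQx⟩, 2), Subtype.ext ?_⟩
        exact (SingularPoint.leftSpace_generator _ m.flip rfl).trans h.symm

theorem incident_toElement_zero_one_iff (P P' : SingularPoint Q) :
    Incident Q (hQ.toElement hm (P, 0)) (hQ.toElement hm (P', 1)) ↔
      m P.generator P'.generator = 0 := by
  have h4 := hQ.finrank_leftSpace hm P'.generator_ne_zero P'.map_generator
  have h := hQ.incident_point_iff (X := hQ.toElement hm (P, 0)) (Y := hQ.toElement hm (P', 1))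
    P.2.2 h4
  rw [h, hm.mul_eq_zero_iff_mem' hQ.nondegenerate P'.generator_ne_zero P'.map_generator]
  change P.1 ≤ leftSpace m P'.generator ↔ _
  rw [P.eq_span, Submodule.span_singleton_le_iff_mem]

theorem incident_toElement_zero_two_iff (P P' : SingularPoint Q) :
    Incident Q (hQ.toElement hm (P, 0)) (hQ.toElement hm (P', 2)) ↔
      m P'.generator P.generator = 0 := by
  have h4 := hQ.finrank_leftSpace hm.flip P'.generator_ne_zero P'.map_generator
  have h := hQ.incident_point_iff (X := hQ.toElement hm (P, 0)) (Y := hQ.toElement hm (P', 2))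
    P.2.2 h4
  rw [h, hm.mul_eq_zero_iff_mem hQ.nondegenerate P'.generator_ne_zero P'.map_generator]
  change P.1 ≤ leftSpace m.flip P'.generator ↔ _
  rw [P.eq_span, Submodule.span_singleton_le_iff_mem]

theorem incident_toElement_one_two_iff (P P' : SingularPoint Q) :
    Incident Q (hQ.toElement hm (P, 1)) (hQ.toElement hm (P', 2)) ↔
      m P.generator P'.generator = 0 := by
  have h4 := hQ.finrank_leftSpace hm P.generator_ne_zero P.map_generator
  have h4' := hQ.finrank_leftSpace hm.flip P'.generator_ne_zero P'.map_generator
  have h := hQ.incident_iff_of_finrank_eq (X := hQ.toElement hm (P, 1))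
    (Y := hQ.toElement hm (P', 2)) (h4.trans h4'.symm)
  rw [h, ← hQ.finrank_inf_flip_eq_three_iff hm P.generator_ne_zero P.map_generator
    P'.generator_ne_zero P'.map_generator]
  exact or_iff_right (hQ.leftSpace_ne_flip hm P.generator_ne_zero
    P.map_generator P'.generator_ne_zero P'.map_generator)

theorem incident_toElement_self_iff (P P' : SingularPoint Q) (i : Fin 3) :
    Incident Q (hQ.toElement hm (P, i)) (hQ.toElement hm (P', i)) ↔ P = P' := by
  have := hQ.finiteDimensional
  have key : ∀ i, Module.finrank K (hQ.toElement hm (P, i)).1 =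
      Module.finrank K (hQ.toElement hm (P', i)).1 →
      Module.finrank K ↥((hQ.toElement hm (P, i)).1 ⊓ (hQ.toElement hm (P', i)).1) ≠ 3 →
      (Incident Q (hQ.toElement hm (P, i)) (hQ.toElement hm (P', i)) ↔ P = P') := by
    intro i h1 h2
    rw [hQ.incident_iff_of_finrank_eq h1, or_iff_left h2]
    constructor
    · intro h
      exact congrArg Prod.fst ((hQ.toElement_bijective hm).1 (Subtype.ext h))
    · rintro rfl; rfl
  fin_cases i
  · refine key 0 (P.2.2.trans P'.2.2.symm) fun h => ?_
    have h1 := Submodule.finrank_mono (inf_le_left : P.1 ⊓ P'.1 ≤ P.1)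
    have h2 := P.2.2
    change Module.finrank K ↥(P.1 ⊓ P'.1) = 3 at h
    omega
  · exact key 1 ((hQ.finrank_leftSpace hm P.generator_ne_zero P.map_generator).trans
      (hQ.finrank_leftSpace hm P'.generator_ne_zero P'.map_generator).symm)
      (hQ.finrank_leftSpace_inf_ne_three hm P.generator_ne_zero P.map_generator
        P'.generator_ne_zero P'.map_generator)
  · exact key 2 ((hQ.finrank_leftSpace hm.flip P.generator_ne_zero P.map_generator).trans
      (hQ.finrank_leftSpace hm.flip P'.generator_ne_zero P'.map_generator).symm)
      (hQ.finrank_leftSpace_inf_ne_three hm.flip P.generator_ne_zero P.map_generator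
        P'.generator_ne_zero P'.map_generator)

/-- With the three kinds labelled by integers modulo 3, the criterion depends only on the difference
of the labels, so shifting them preserves incidence. -/
theorem incident_toElement_iff (P P' : SingularPoint Q) (i j : Fin 3) :
    Incident Q (hQ.toElement hm (P, i)) (hQ.toElement hm (P', j)) ↔
      (i = j ∧ P = P') ∨ (j = i + 1 ∧ m P.generator P'.generator = 0) ∨
        (i = j + 1 ∧ m P'.generator P.generator = 0) := by
  fin_cases i <;> fin_cases j
  · simpa using hQ.incident_toElement_self_iff hm P P' 0
  · simpa using hQ.incident_toElement_zero_one_iff hm P P'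
  · simpa using hQ.incident_toElement_zero_two_iff hm P P'
  · simpa using incident_comm.trans (hQ.incident_toElement_zero_one_iff hm P' P)
  · simpa using hQ.incident_toElement_self_iff hm P P' 1
  · simpa using hQ.incident_toElement_one_two_iff hm P P'
  · simpa using incident_comm.trans (hQ.incident_toElement_zero_two_iff hm P' P)
  · simpa using incident_comm.trans (hQ.incident_toElement_one_two_iff hm P' P)
  · simpa using hQ.incident_toElement_self_iff hm P P' 2

/-- The triality map `P ↦ P * V ↦ V * P ↦ P`. -/
noncomputable def triality : Equiv.Perm (Element Q) :=
  (Equiv.ofBijective _ (hQ.toElement_bijective hm)).permCongr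
    ((Equiv.refl _).prodCongr (Equiv.addRight 1))

theorem triality_toElement (P : SingularPoint Q) (i : Fin 3) :
    hQ.triality hm (hQ.toElement hm (P, i)) = hQ.toElement hm (P, i + 1) := by
  have : (Equiv.ofBijective _ (hQ.toElement_bijective hm)).symm (hQ.toElement hm (P, i)) = (P, i) :=
    Equiv.ofBijective_symm_apply_apply _ _ _
  simp [triality, Equiv.permCongr_apply, this]

theorem exists_eq_toElement_zero {X : Element Q} (hX : Module.finrank K X.1 = 1) :
    ∃ P : SingularPoint Q, P.1 = X.1 ∧ X = hQ.toElement hm (P, 0) :=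
  ⟨⟨X.1, X.2.1, hX⟩, rfl, rfl⟩

theorem triality_coe_of_eq_span {X : Element Q} {x : V} (hx : x ≠ 0) (hX : X.1 = K ∙ x) :
    (hQ.triality hm X).1 = leftSpace m x := by
  obtain ⟨P, hP, rfl⟩ := hQ.exists_eq_toElement_zero hm (X := X)
    (by rw [hX, finrank_span_singleton hx])
  rw [triality_toElement]
  exact P.leftSpace_generator m (hP.trans hX)

theorem isTriality_triality : IsTriality Q (hQ.triality hm) where
  incident_iff X Y := by
    obtain ⟨⟨P, i⟩, rfl⟩ := (hQ.toElement_bijective hm).2 X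
    obtain ⟨⟨P', j⟩, rfl⟩ := (hQ.toElement_bijective hm).2 Y
    rw [triality_toElement, triality_toElement, incident_toElement_iff, incident_toElement_iff]
    simp only [add_left_inj]
  order_three X := by
    obtain ⟨⟨P, i⟩, rfl⟩ := (hQ.toElement_bijective hm).2 X
    rw [triality_toElement, triality_toElement, triality_toElement]
    congr 2
    revert i
    decide
  finrank_eq X hX := by
    obtain ⟨P, -, rfl⟩ := hQ.exists_eq_toElement_zero hm hX
    rw [triality_toElement]
    exact hQ.finrank_leftSpace hm P.generator_ne_zero P.map_generator
  same_type X Y hX hY := by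
    obtain ⟨P, -, rfl⟩ := hQ.exists_eq_toElement_zero hm hX
    obtain ⟨P', -, rfl⟩ := hQ.exists_eq_toElement_zero hm hY
    rw [triality_toElement, triality_toElement]
    exact hQ.even_finrank_leftSpace_inf hm P.generator_ne_zero P.map_generator
      P'.generator_ne_zero P'.map_generator

end IsOPlus8

end TrialityMap

/-! ### The anisotropic binary form x² + xy + cy² -/

section BinaryForm

variable {K : Type*} [Field K]

/-- The map t ↦ -(t² + t) agrees at 0 and -1, so on a finite field it is not surjective. -/
theorem exists_forall_sq_add_self_add_ne_zero (K : Type*) [Field K] [Finite K] :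
    ∃ c : K, ∀ t : K, t ^ 2 + t + c ≠ 0 := by
  by_contra! h
  have hsurj : Function.Surjective fun t : K => -(t ^ 2 + t) := by
    intro c
    obtain ⟨t, ht⟩ := h c
    exact ⟨t, by linear_combination -ht⟩
  have := Finite.injective_iff_surjective.2 hsurj (a₁ := 0) (a₂ := -1) (by norm_num)
  simp at this

theorem eq_zero_of_binaryForm_eq_zero {c : K} (hc : ∀ t : K, t ^ 2 + t + c ≠ 0) {x y : K}
    (h : x ^ 2 + x * y + c * y ^ 2 = 0) : x = 0 ∧ y = 0 := by
  by_cases hy : y = 0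
  · subst hy
    simpa using h
  · refine (hc (x / y) ?_).elim
    field_simp
    linear_combination h

theorem four_mul_sub_one_ne_zero {c : K} (hc : ∀ t : K, t ^ 2 + t + c ≠ 0) : 4 * c - 1 ≠ 0 := by
  intro h
  -- With zero discriminant 1 - 4c this is the double root -1/2, written without division.
  apply hc (-2 * c)
  linear_combination c * h

theorem exists_binaryForm_eq [Finite K] {c : K} (hc : ∀ t : K, t ^ 2 + t + c ≠ 0) (d : K) :
    ∃ x y, x ^ 2 + x * y + c * y ^ 2 = d := by
  by_cases h2 : ringChar K = 2
  · obtain ⟨x, hx⟩ := FiniteField.isSquare_of_char_two h2 d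
    exact ⟨x, 0, by rw [hx]; ring⟩
  · have := Fintype.ofFinite K
    have h20 : (2 : K) ≠ 0 := Ring.two_ne_zero h2
    have hD : c - 4⁻¹ ≠ 0 := by
      intro h
      apply four_mul_sub_one_ne_zero hc
      have h4 : (4 : K) ≠ 0 := by
        rw [show (4 : K) = 2 * 2 by norm_num]; exact mul_ne_zero h20 h20
      field_simp at h
      linear_combination h
    obtain ⟨a, b, hab⟩ := FiniteField.exists_root_sum_quadratic
      (f := Polynomial.X ^ 2 - Polynomial.C d) (g := Polynomial.C (c - 4⁻¹) * Polynomial.X ^ 2)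
      (Polynomial.degree_X_pow_sub_C (by norm_num) d)
      (by rw [Polynomial.degree_C_mul_X_pow _ hD]; rfl)
      (FiniteField.odd_card_of_char_ne_two h2)
    -- Completing the square: x² + xy + cy² = (x + y/2)² + (c - 1/4) y².
    refine ⟨a - b / 2, b, ?_⟩
    simp only [Polynomial.eval_sub, Polynomial.eval_pow, Polynomial.eval_X, Polynomial.eval_C,
      Polynomial.eval_mul] at hab
    rw [show (4 : K) = 2 * 2 by norm_num] at hab
    field_simp at hab ⊢
    linear_combination hab

theorem exists_binaryForm_root [Finite K] {c : K} (hc : ∀ t : K, t ^ 2 + t + c ≠ 0)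
    {b : K} (hb : b ≠ 0) (a u v : K) :
    ∃ x y, a + u * x + v * y + b * (x ^ 2 + x * y + c * y ^ 2) = 0 := by
  obtain ⟨D, hD, hD0⟩ : ∃ D, D = 4 * c - 1 ∧ D ≠ 0 := ⟨_, rfl, four_mul_sub_one_ne_zero hc⟩
  -- A translation absorbs the linear terms: the gradient of the binary form is a linear map with
  -- determinant 4c - 1 ≠ 0, so this works in characteristic 2 too. What remains is that the form
  -- takes every value.
  let x₀ := (2 * c * u - v) / (b * D)
  let y₀ := (2 * v - u) / (b * D)
  have hx : b * (2 * x₀ + y₀) = u := by simp only [x₀, y₀]; field_simp; rw [hD]; ring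
  have hy : b * (x₀ + 2 * c * y₀) = v := by simp only [x₀, y₀]; field_simp; rw [hD]; ring
  obtain ⟨s, t, h⟩ := exists_binaryForm_eq hc (x₀ ^ 2 + x₀ * y₀ + c * y₀ ^ 2 - a / b)
  refine ⟨s - x₀, t - y₀, ?_⟩
  have h' : b * (s ^ 2 + s * t + c * t ^ 2) = b * (x₀ ^ 2 + x₀ * y₀ + c * y₀ ^ 2) - a := by
    rw [h]; field_simp
  rw [← hx, ← hy]
  linear_combination h'

end BinaryForm

/-! ### Elliptic quadrics in coordinates -/

section EllipticFrame

variable {K V : Type*} [Field K] [AddCommGroup V] [Module K V]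

/-- A basis of an `O⁻(4, q)`-space, consisting of a hyperbolic pair and a basis of its
perpendicular plane on which the form is `ε (x² + x y + c y²)`. -/
structure IsEllipticFrame (Q : QuadraticForm K V) (c ε : K) (F : Fin 4 → V) : Prop where
  map_zero : Q (F 0) = 0
  map_one : Q (F 1) = 0
  map_two : Q (F 2) = ε
  map_three : Q (F 3) = ε * c
  polar_zero_one : QuadraticMap.polar Q (F 0) (F 1) = 1
  polar_zero_two : QuadraticMap.polar Q (F 0) (F 2) = 0
  polar_zero_three : QuadraticMap.polar Q (F 0) (F 3) = 0
  polar_one_two : QuadraticMap.polar Q (F 1) (F 2) = 0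
  polar_one_three : QuadraticMap.polar Q (F 1) (F 3) = 0
  polar_two_three : QuadraticMap.polar Q (F 2) (F 3) = ε

/-- The vector with given coordinates in a frame. -/
def frameVector (F : Fin 4 → V) (a : Fin 4 → K) : V :=
  a 0 • F 0 + a 1 • F 1 + a 2 • F 2 + a 3 • F 3

/-- The subspace spanned by a frame. -/
def frameSpace (K : Type*) {V : Type*} [Field K] [AddCommGroup V] [Module K V] (F : Fin 4 → V) :
    Submodule K V :=
  Submodule.span K (Set.range F)

theorem mem_frameSpace {F : Fin 4 → V} {v : V} :
    v ∈ frameSpace K F ↔ ∃ a : Fin 4 → K, v = frameVector F a := by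
  rw [frameSpace, Submodule.mem_span_range_iff_exists_fun]
  simp only [Fin.sum_univ_four, frameVector, eq_comm]

namespace IsEllipticFrame

variable {Q : QuadraticForm K V} {c ε : K} {F : Fin 4 → V}

theorem polar_frameVector (hF : IsEllipticFrame Q c ε F) (a b : Fin 4 → K) :
    QuadraticMap.polar Q (frameVector F a) (frameVector F b) = a 0 * b 1 + a 1 * b 0 +
      ε * (2 * a 2 * b 2 + a 2 * b 3 + a 3 * b 2 + 2 * c * a 3 * b 3) := by
  simp only [frameVector, QuadraticMap.polar_add_left, QuadraticMap.polar_add_right,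
    QuadraticMap.polar_smul_left, QuadraticMap.polar_smul_right, QuadraticMap.polar_self,
    QuadraticMap.polar_comm Q (F 1) (F 0), QuadraticMap.polar_comm Q (F 2) (F 0),
    QuadraticMap.polar_comm Q (F 3) (F 0), QuadraticMap.polar_comm Q (F 2) (F 1),
    QuadraticMap.polar_comm Q (F 3) (F 1), QuadraticMap.polar_comm Q (F 3) (F 2),
    hF.map_zero, hF.map_one, hF.map_two, hF.map_three, hF.polar_zero_one, hF.polar_zero_two,
    hF.polar_zero_three, hF.polar_one_two, hF.polar_one_three, hF.polar_two_three, smul_eq_mul,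
    nsmul_eq_mul]
  push_cast
  ring

theorem map_frameVector (hF : IsEllipticFrame Q c ε F) (a : Fin 4 → K) :
    Q (frameVector F a) = a 0 * a 1 + ε * (a 2 ^ 2 + a 2 * a 3 + c * a 3 ^ 2) := by
  simp only [frameVector, QuadraticMap.map_add Q, QuadraticMap.map_smul,
    QuadraticMap.polar_add_left, QuadraticMap.polar_smul_left, QuadraticMap.polar_smul_right,
    hF.map_zero, hF.map_one, hF.map_two, hF.map_three, hF.polar_zero_one, hF.polar_zero_two,
    hF.polar_zero_three, hF.polar_one_two, hF.polar_one_three, hF.polar_two_three, smul_eq_mul]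
  ring

theorem polar_apply_zero (hF : IsEllipticFrame Q c ε F) (a : Fin 4 → K) :
    QuadraticMap.polar Q (frameVector F a) (F 0) = a 1 := by
  have h := hF.polar_frameVector a ![1, 0, 0, 0]
  simpa [frameVector] using h

theorem frameVector_eq_smul (hF : IsEllipticFrame Q c ε F) (hε : ε ≠ 0)
    (hc : ∀ t : K, t ^ 2 + t + c ≠ 0) {a : Fin 4 → K} (h : Q (frameVector F a) = 0)
    (h1 : a 1 = 0) : frameVector F a = a 0 • F 0 := by
  rw [hF.map_frameVector, h1, mul_zero, zero_add] at h
  obtain ⟨h2, h3⟩ := eq_zero_of_binaryForm_eq_zero hc ((mul_eq_zero.1 h).resolve_left hε)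
  simp [frameVector, h1, h2, h3]

theorem ne_zero (hF : IsEllipticFrame Q c ε F) : F 0 ≠ 0 := by
  intro h
  have := hF.polar_zero_one
  rw [h, QuadraticMap.polar_zero_left] at this
  exact zero_ne_one this

theorem eq_zero_of_forall_polar (hF : IsEllipticFrame Q c ε F) (hε : ε ≠ 0)
    (hc : ∀ t : K, t ^ 2 + t + c ≠ 0) {a : Fin 4 → K}
    (h : ∀ b : Fin 4 → K, QuadraticMap.polar Q (frameVector F a) (frameVector F b) = 0) :
    a = 0 := by
  simp only [hF.polar_frameVector] at h
  have h0 := h ![1, 0, 0, 0]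
  have h1 := h ![0, 1, 0, 0]
  have h2 := h ![0, 0, 1, 0]
  have h3 := h ![0, 0, 0, 1]
  simp [hε] at h0 h1 h2 h3
  have ha3 : a 3 = 0 := by
    refine (mul_eq_zero.1 (?_ : (4 * c - 1) * a 3 = 0)).resolve_left (four_mul_sub_one_ne_zero hc)
    linear_combination 2 * h3 - h2
  have ha2 : a 2 = 0 := by linear_combination h3 - 2 * c * ha3
  ext i
  fin_cases i
  · exact h1
  · exact h0
  · exact ha2
  · exact ha3

/-- Singular vectors of the frame space perpendicular to `F 0` are multiples of it. If u in `W` is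
not perpendicular to `F 0`, any w in `W` differs from a multiple of u by such a vector, which is
also perpendicular to u and hence 0. -/
theorem le_span_of_isTotallySingular (hF : IsEllipticFrame Q c ε F) (hε : ε ≠ 0)
    (hc : ∀ t : K, t ^ 2 + t + c ≠ 0) {W : Submodule K V} (hW : IsTotallySingular Q W)
    (hle : W ≤ frameSpace K F) : ∃ u, W ≤ K ∙ u := by
  by_cases h : ∃ u ∈ W, QuadraticMap.polar Q u (F 0) ≠ 0
  · obtain ⟨u, hu, hu0⟩ := h
    refine ⟨u, fun w hw => ?_⟩
    let k := QuadraticMap.polar Q w (F 0) / QuadraticMap.polar Q u (F 0)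
    have hwk : w - k • u ∈ W := W.sub_mem hw (W.smul_mem _ hu)
    obtain ⟨a, ha⟩ := mem_frameSpace.1 (hle hwk)
    have h1 : a 1 = 0 := by
      rw [← hF.polar_apply_zero a, ← ha, QuadraticMap.polar_sub_left, QuadraticMap.polar_smul_left,
        smul_eq_mul, div_mul_cancel₀ _ hu0, sub_self]
    have h2 := hF.frameVector_eq_smul hε hc (ha ▸ hW _ hwk) h1
    have h3 := hW.polar_eq_zero hwk hu
    rw [ha, h2, QuadraticMap.polar_smul_left, QuadraticMap.polar_comm] at h3
    rw [(smul_eq_zero.1 h3).resolve_right hu0, zero_smul, ← ha, sub_eq_zero] at h2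
    rw [h2]
    exact Submodule.smul_mem _ _ (Submodule.mem_span_singleton_self u)
  · push Not at h
    refine ⟨F 0, fun w hw => ?_⟩
    obtain ⟨a, rfl⟩ := mem_frameSpace.1 (hle hw)
    rw [hF.frameVector_eq_smul hε hc (hW _ hw) (by rw [← hF.polar_apply_zero a, h _ hw])]
    exact Submodule.smul_mem _ _ (Submodule.mem_span_singleton_self _)

theorem frame_mem (F : Fin 4 → V) (i : Fin 4) : F i ∈ frameSpace K F :=
  Submodule.subset_span ⟨i, rfl⟩

theorem isOMinus4 (hF : IsEllipticFrame Q c ε F) (hε : ε ≠ 0)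
    (hc : ∀ t : K, t ^ 2 + t + c ≠ 0) : IsOMinus4 (Q.comp (frameSpace K F).subtype) where
  finrank_eq := by
    have : LinearIndependent K F := by
      rw [Fintype.linearIndependent_iff]
      intro a ha
      have : a = 0 := hF.eq_zero_of_forall_polar hε hc fun b => by
        have : frameVector F a = 0 := by rw [← ha, Fin.sum_univ_four, frameVector]
        rw [this, QuadraticMap.polar_zero_left]
      simp [this]
    rw [frameSpace, finrank_span_eq_card this, Fintype.card_fin]
  nondegenerate := by
    have key : ∀ u : frameSpace K F,
        (∀ w : frameSpace K F, QuadraticMap.polar Q u.1 w.1 = 0) → u = 0 := by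
      rintro ⟨u, hu⟩ h
      obtain ⟨a, rfl⟩ := mem_frameSpace.1 hu
      have : a = 0 := hF.eq_zero_of_forall_polar hε hc fun b =>
        h ⟨frameVector F b, mem_frameSpace.2 ⟨b, rfl⟩⟩
      subst this
      simp [frameVector]
    have hp : ∀ u w : frameSpace K F, (Q.comp (frameSpace K F).subtype).polarBilin u w =
        QuadraticMap.polar Q u.1 w.1 := fun u w => rfl
    refine ⟨fun u h => key u fun w => (hp u w).symm.trans (h w), fun u h => key u fun w => ?_⟩
    rw [QuadraticMap.polar_comm]
    exact (hp w u).symm.trans (h w)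
  wittIndex := by
    constructor
    · have hne : (⟨F 0, frame_mem F 0⟩ : frameSpace K F) ≠ 0 :=
        fun h => hF.ne_zero (congrArg Subtype.val h)
      obtain ⟨h1, h2⟩ := isSingularPoint_span (Q := Q.comp (frameSpace K F).subtype) hne hF.map_zero
      exact ⟨_, h1, h2⟩
    · rintro d ⟨W, hW, rfl⟩
      obtain ⟨u, hu⟩ := hF.le_span_of_isTotallySingular hε hc (W := W.map (frameSpace K F).subtype)
        (by rintro _ ⟨w, hw, rfl⟩; exact hW w hw) (Submodule.map_subtype_le _ _)
      rw [← Submodule.finrank_map_subtype_eq]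
      exact (Submodule.finrank_mono hu).trans (finrank_span_le_card _ |>.trans (by simp))

/-- A vector spanning the singular point with affine coordinates `s` of an elliptic quadric. -/
def quadricVector (c ε : K) (F : Fin 4 → V) (s : K × K) : V :=
  frameVector F ![-ε * (s.1 ^ 2 + s.1 * s.2 + c * s.2 ^ 2), 1, s.1, s.2]

theorem map_quadricVector (hF : IsEllipticFrame Q c ε F) (s : K × K) :
    Q (quadricVector c ε F s) = 0 := by
  rw [quadricVector, hF.map_frameVector]; simp

theorem quadricVector_ne_zero (hF : IsEllipticFrame Q c ε F) (s : K × K) :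
    quadricVector c ε F s ≠ 0 := by
  intro h
  have := hF.polar_apply_zero ![-ε * (s.1 ^ 2 + s.1 * s.2 + c * s.2 ^ 2), 1, s.1, s.2]
  rw [← quadricVector, h, QuadraticMap.polar_zero_left] at this
  simp at this

theorem polar_quadricVector (hF : IsEllipticFrame Q c ε F) (s t : K × K) :
    QuadraticMap.polar Q (quadricVector c ε F s) (quadricVector c ε F t) =
      -ε * ((s.1 - t.1) ^ 2 + (s.1 - t.1) * (s.2 - t.2) + c * (s.2 - t.2) ^ 2) := by
  rw [quadricVector, quadricVector, hF.polar_frameVector]; simp; ring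

theorem polar_quadricVector_ne_zero (hF : IsEllipticFrame Q c ε F) (hε : ε ≠ 0)
    (hc : ∀ t : K, t ^ 2 + t + c ≠ 0) {s t : K × K} (hst : s ≠ t) :
    QuadraticMap.polar Q (quadricVector c ε F s) (quadricVector c ε F t) ≠ 0 := by
  rw [hF.polar_quadricVector]
  refine mul_ne_zero (neg_ne_zero.2 hε) fun h => hst ?_
  obtain ⟨h1, h2⟩ := eq_zero_of_binaryForm_eq_zero hc h
  exact Prod.ext (sub_eq_zero.1 h1) (sub_eq_zero.1 h2)

theorem singularPoints_diff (hF : IsEllipticFrame Q c ε F) (hε : ε ≠ 0)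
    (hc : ∀ t : K, t ^ 2 + t + c ≠ 0) :
    singularPoints Q (frameSpace K F) \ {K ∙ F 0} =
      Set.range fun s => K ∙ quadricVector c ε F s := by
  ext P
  constructor
  · rintro ⟨⟨hP, hle⟩, hne⟩
    obtain ⟨v, hv, hQv, rfl⟩ := hP.exists_generator
    obtain ⟨a, rfl⟩ := mem_frameSpace.1 ((Submodule.span_singleton_le_iff_mem _ _).1 hle)
    have ha : a 1 ≠ 0 := by
      intro h1
      exact hne (span_singleton_eq_of_eq_smul hv (hF.frameVector_eq_smul hε hc hQv h1))
    refine ⟨(a 2 / a 1, a 3 / a 1), (span_singleton_eq_of_eq_smul (c := a 1) hv ?_).symm⟩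
    have h0 : a 1 * (-ε * ((a 2 / a 1) ^ 2 + a 2 / a 1 * (a 3 / a 1) + c * (a 3 / a 1) ^ 2)) =
        a 0 := by
      rw [hF.map_frameVector] at hQv
      field_simp
      linear_combination -hQv
    simp only [quadricVector, frameVector, smul_add, smul_smul]
    simp [mul_div_cancel₀ _ ha]
    rw [← h0]; module
  · rintro ⟨s, rfl⟩
    refine ⟨⟨isSingularPoint_span (hF.quadricVector_ne_zero s) (hF.map_quadricVector s), ?_⟩, ?_⟩
    · rw [Submodule.span_singleton_le_iff_mem, mem_frameSpace]
      exact ⟨_, rfl⟩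
    · intro h
      obtain ⟨k, hk⟩ := Submodule.mem_span_singleton.1
        ((h : (K ∙ quadricVector c ε F s) = K ∙ F 0) ▸ Submodule.mem_span_singleton_self _ :
          quadricVector c ε F s ∈ K ∙ F 0)
      have := hF.polar_apply_zero ![-ε * (s.1 ^ 2 + s.1 * s.2 + c * s.2 ^ 2), 1, s.1, s.2]
      rw [← quadricVector, ← hk, QuadraticMap.polar_smul_left, QuadraticMap.polar_self,
        hF.map_zero] at this
      simp at this

end IsEllipticFrame

end EllipticFrame

/-! ### The configuration of two linked quadrics -/

section TwoQuadrics

variable {K V : Type*} [Field K] [AddCommGroup V] [Module K V]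

theorem polar_frameVector_frameVector {Q : QuadraticForm K V} {F F' : Fin 4 → V}
    (hx : ∀ i j, QuadraticMap.polar Q (F i) (F' j) = if i = 1 ∧ j = 1 then 1 else 0)
    (a b : Fin 4 → K) : QuadraticMap.polar Q (frameVector F a) (frameVector F' b) = a 1 * b 1 := by
  simp only [frameVector, QuadraticMap.polar_add_left, QuadraticMap.polar_add_right,
    QuadraticMap.polar_smul_left, QuadraticMap.polar_smul_right, hx]
  simp [mul_comm]

/-- The vectors spanning the points of two elliptic quadrics other than `p` and `p'`, and a vector
spanning a point of the line `⟨p, p'⟩`. -/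
def configurationVector (c ε ε' : K) (F F' : Fin 4 → V) : Option ((K × K) ⊕ (K × K)) → V
  | none => F 0 + F' 0
  | some (Sum.inl s) => IsEllipticFrame.quadricVector c ε F s
  | some (Sum.inr s) => IsEllipticFrame.quadricVector c ε' F' s

/-- The singular points spanned by the vectors `configurationVector`. -/
def configuration (c ε ε' : K) (F F' : Fin 4 → V) : Set (Submodule K V) :=
  Set.range fun i => K ∙ configurationVector c ε ε' F F' i

namespace IsEllipticFrame

variable {Q : QuadraticForm K V} {c ε ε' : K} {F F' : Fin 4 → V}

theorem frameVector_zero (F : Fin 4 → V) : F 0 = frameVector F ![(1 : K), 0, 0, 0] := by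
  simp [frameVector]

theorem map_configurationVector (hF : IsEllipticFrame Q c ε F) (hF' : IsEllipticFrame Q c ε' F')
    (hx : ∀ i j, QuadraticMap.polar Q (F i) (F' j) = if i = 1 ∧ j = 1 then 1 else 0)
    (i : Option ((K × K) ⊕ (K × K))) : Q (configurationVector c ε ε' F F' i) = 0 := by
  rcases i with _ | s | s
  · rw [configurationVector, QuadraticMap.map_add Q, hF.map_zero, hF'.map_zero, hx]; simp
  · exact hF.map_quadricVector s
  · exact hF'.map_quadricVector s

theorem polar_configurationVector_ne_zero (hF : IsEllipticFrame Q c ε F)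
    (hF' : IsEllipticFrame Q c ε' F') (hε : ε ≠ 0) (hε' : ε' ≠ 0)
    (hc : ∀ t : K, t ^ 2 + t + c ≠ 0)
    (hx : ∀ i j, QuadraticMap.polar Q (F i) (F' j) = if i = 1 ∧ j = 1 then 1 else 0)
    {i j : Option ((K × K) ⊕ (K × K))} (hij : i ≠ j) :
    QuadraticMap.polar Q (configurationVector c ε ε' F F' i)
      (configurationVector c ε ε' F F' j) ≠ 0 := by
  have h1 : ∀ s, QuadraticMap.polar Q (F 0 + F' 0) (quadricVector c ε F s) = 1 := fun s => by
    rw [quadricVector, QuadraticMap.polar_comm, QuadraticMap.polar_add_right, hF.polar_apply_zero,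
      frameVector_zero (K := K) F', polar_frameVector_frameVector hx]
    simp
  have h2 : ∀ s, QuadraticMap.polar Q (F 0 + F' 0) (quadricVector c ε' F' s) = 1 := fun s => by
    rw [quadricVector, QuadraticMap.polar_add_left, QuadraticMap.polar_comm Q (F' 0),
      hF'.polar_apply_zero, frameVector_zero (K := K) F, polar_frameVector_frameVector hx]
    simp
  have h3 : ∀ s t, QuadraticMap.polar Q (quadricVector c ε F s) (quadricVector c ε' F' t) = 1 :=
    fun s t => by rw [quadricVector, quadricVector, polar_frameVector_frameVector hx]; simp
  rcases i with _ | s | s <;> rcases j with _ | t | t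
  · exact (hij rfl).elim
  · exact (h1 t).trans_ne one_ne_zero
  · exact (h2 t).trans_ne one_ne_zero
  · rw [QuadraticMap.polar_comm]; exact (h1 s).trans_ne one_ne_zero
  · exact hF.polar_quadricVector_ne_zero hε hc fun h => hij (h ▸ rfl)
  · exact (h3 s t).trans_ne one_ne_zero
  · rw [QuadraticMap.polar_comm]; exact (h2 s).trans_ne one_ne_zero
  · rw [QuadraticMap.polar_comm]; exact (h3 t s).trans_ne one_ne_zero
  · exact hF'.polar_quadricVector_ne_zero hε' hc fun h => hij (h ▸ rfl)

theorem configurationVector_ne_zero (hF : IsEllipticFrame Q c ε F)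
    (hF' : IsEllipticFrame Q c ε' F') (hε : ε ≠ 0) (hε' : ε' ≠ 0)
    (hc : ∀ t : K, t ^ 2 + t + c ≠ 0)
    (hx : ∀ i j, QuadraticMap.polar Q (F i) (F' j) = if i = 1 ∧ j = 1 then 1 else 0)
    (i : Option ((K × K) ⊕ (K × K))) : configurationVector c ε ε' F F' i ≠ 0 := by
  obtain ⟨j, hj⟩ := exists_ne i
  intro h
  apply hF.polar_configurationVector_ne_zero hF' hε hε' hc hx hj.symm
  rw [h, QuadraticMap.polar_zero_left]

/-- In the affine coordinates of the quadric the pairing with z is a quadratic polynomial whose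
leading form is -ε (z, `F 0`) times the anisotropic form. -/
theorem exists_polar_quadricVector_eq_zero [Finite K] (hε : ε ≠ 0)
    (hc : ∀ t : K, t ^ 2 + t + c ≠ 0) {z : V} (hz : QuadraticMap.polar Q z (F 0) ≠ 0) :
    ∃ s, QuadraticMap.polar Q z (quadricVector c ε F s) = 0 := by
  obtain ⟨x, y, h⟩ := exists_binaryForm_root hc
    (mul_ne_zero (neg_ne_zero.2 hε) hz) (QuadraticMap.polar Q z (F 1))
    (QuadraticMap.polar Q z (F 2)) (QuadraticMap.polar Q z (F 3))
  refine ⟨(x, y), ?_⟩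
  simp [quadricVector, frameVector, QuadraticMap.polar_add_right]
  linear_combination h

/-- The source of all maximality claims. The extra point serves exactly the z perpendicular to both
removed points. -/
theorem exists_polar_configurationVector_eq_zero [Finite K] (hε : ε ≠ 0) (hε' : ε' ≠ 0)
    (hc : ∀ t : K, t ^ 2 + t + c ≠ 0) (Q : QuadraticForm K V) (F F' : Fin 4 → V) (z : V) :
    ∃ i, QuadraticMap.polar Q z (configurationVector c ε ε' F F' i) = 0 := by
  by_cases h : QuadraticMap.polar Q z (F 0) = 0
  · by_cases h' : QuadraticMap.polar Q z (F' 0) = 0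
    · exact ⟨none, by rw [configurationVector, QuadraticMap.polar_add_right, h, h', add_zero]⟩
    · obtain ⟨s, hs⟩ := exists_polar_quadricVector_eq_zero hε' hc h'
      exact ⟨some (Sum.inr s), hs⟩
  · obtain ⟨s, hs⟩ := exists_polar_quadricVector_eq_zero hε hc h
    exact ⟨some (Sum.inl s), hs⟩

theorem isTwoQuadricConfiguration (hF : IsEllipticFrame Q c ε F)
    (hF' : IsEllipticFrame Q c ε' F') (hε : ε ≠ 0) (hε' : ε' ≠ 0)
    (hc : ∀ t : K, t ^ 2 + t + c ≠ 0)
    (hx : ∀ i j, QuadraticMap.polar Q (F i) (F' j) = if i = 1 ∧ j = 1 then 1 else 0) :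
    IsTwoQuadricConfiguration Q (configuration c ε ε' F F') := by
  have hx' : ∀ i j, QuadraticMap.polar Q (F' i) (F j) = if i = 1 ∧ j = 1 then 1 else 0 := by
    intro i j
    rw [QuadraticMap.polar_comm, hx]
    simp only [and_comm]
  have tangent : ∀ {ε : K} {F F' : Fin 4 → V}, IsEllipticFrame Q c ε F →
      (∀ i j, QuadraticMap.polar Q (F i) (F' j) = if i = 1 ∧ j = 1 then 1 else 0) →
      Perpendicular Q (perp Q (K ∙ F 0) ⊓ frameSpace K F) (frameSpace K F') := by
    rintro ε F F' hF hx v ⟨hv, hvF⟩ w hw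
    obtain ⟨a, rfl⟩ := mem_frameSpace.1 hvF
    obtain ⟨b, rfl⟩ := mem_frameSpace.1 hw
    have h := (LinearMap.BilinForm.mem_orthogonal_iff.1 hv) (F 0)
      (Submodule.mem_span_singleton_self _)
    change QuadraticMap.polar Q (F 0) (frameVector F a) = 0 at h
    rw [QuadraticMap.polar_comm, hF.polar_apply_zero] at h
    rw [polar_frameVector_frameVector hx, h, zero_mul]
  have point : ∀ {ε : K} {F : Fin 4 → V}, IsEllipticFrame Q c ε F →
      K ∙ F 0 ∈ singularPoints Q (frameSpace K F) := fun {ε F} hF =>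
    ⟨isSingularPoint_span hF.ne_zero hF.map_zero, by
      rw [Submodule.span_singleton_le_iff_mem]; exact frame_mem F 0⟩
  have hsum : F 0 + F' 0 ≠ 0 :=
    hF.configurationVector_ne_zero hF' hε hε' hc hx none
  have hne : ∀ {G : Fin 4 → V} {δ : K}, IsEllipticFrame Q c δ G → (∃ w,
      QuadraticMap.polar Q (G 0) w = 0 ∧ QuadraticMap.polar Q (F 0 + F' 0) w ≠ 0) →
      K ∙ (F 0 + F' 0) ≠ K ∙ G 0 := by
    rintro G δ - ⟨w, hw, hw'⟩ h
    obtain ⟨k, hk⟩ := Submodule.mem_span_singleton.1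
      (h ▸ Submodule.mem_span_singleton_self _ : F 0 + F' 0 ∈ K ∙ G 0)
    rw [← hk, QuadraticMap.polar_smul_left, hw, smul_zero] at hw'
    exact hw' rfl
  refine ⟨frameSpace K F, frameSpace K F', K ∙ F 0, K ∙ F' 0, K ∙ (F 0 + F' 0),
    hF.isOMinus4 hε hc, hF'.isOMinus4 hε' hc, fun h => ?_, point hF, point hF', tangent hF hx,
    tangent hF' hx', finrank_span_singleton hsum, ?_, hne hF ⟨F' 1, ?_, ?_⟩, hne hF' ⟨F 1, ?_, ?_⟩,
    ?_⟩
  · have := h (F 1) (frame_mem F 1) (F' 1) (frame_mem F' 1)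
    rw [hx] at this
    simp at this
  · rw [Submodule.span_singleton_le_iff_mem]
    exact Submodule.add_mem_sup (Submodule.mem_span_singleton_self _)
      (Submodule.mem_span_singleton_self _)
  · rw [hx]; simp
  · rw [QuadraticMap.polar_add_left, hx, hF'.polar_zero_one]; simp
  · rw [hx']; simp
  · rw [QuadraticMap.polar_add_left, hx', hF.polar_zero_one]; simp
  · rw [hF.singularPoints_diff hε hc, hF'.singularPoints_diff hε' hc]
    ext P
    simp only [configuration, Set.mem_range, Set.mem_union, Set.mem_singleton_iff, Option.exists,
      Sum.exists, configurationVector]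
    rw [or_comm, eq_comm]

end IsEllipticFrame

/-- The polar form of the hyperbolic form. -/
theorem polar_hyperbolicNorm (x y : (Fin 4 → K) × (Fin 4 → K)) :
    QuadraticMap.polar hyperbolicNorm x y = ∑ i, (x.1 i * y.2 i + y.1 i * x.2 i) := by
  simp only [QuadraticMap.polar, hyperbolicNorm, ← Finset.sum_sub_distrib]
  refine Finset.sum_congr rfl fun i _ => ?_
  simp only [Prod.fst_add, Prod.snd_add, Pi.add_apply]
  ring

theorem exists_linked_frames {Q : QuadraticForm K V} {φ : V ≃ₗ[K] (Fin 4 → K) × (Fin 4 → K)}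
    (hφ : ∀ v, Q v = hyperbolicNorm (φ v)) (c : K) :
    ∃ F F' : Fin 4 → V, IsEllipticFrame Q c 1 F ∧ IsEllipticFrame Q c (-1) F' ∧
      ∀ i j, QuadraticMap.polar Q (F i) (F' j) = if i = 1 ∧ j = 1 then 1 else 0 := by
  -- The last two vectors of `G` and of `G'` span perpendicular planes in the hyperbolic 4-space of
  -- coordinates 2 and 3, carrying the binary form and its negative; hence the signs 1 and -1. The
  -- hyperbolic pairs use coordinates 0 and 1, and the first coordinate 1 added to `G' 1` creates
  -- the only link, with `G 1`.
  let G : Fin 4 → (Fin 4 → K) × (Fin 4 → K) :=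
    ![(![1, 0, 0, 0], ![0, 0, 0, 0]), (![0, 0, 0, 0], ![1, 0, 0, 0]),
      (![0, 0, 1, 0], ![0, 0, 1, 0]), (![0, 0, 1, c], ![0, 0, 0, 1])]
  let G' : Fin 4 → (Fin 4 → K) × (Fin 4 → K) :=
    ![(![0, 1, 0, 0], ![0, 0, 0, 0]), (![1, 0, 0, 0], ![0, 1, 0, 0]),
      (![0, 0, -1, -1], ![0, 0, 1, 0]), (![0, 0, 0, -c], ![0, 0, 0, 1])]
  have hQ : ∀ x, Q (φ.symm x) = hyperbolicNorm x := fun x => by rw [hφ, φ.apply_symm_apply]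
  have hp : ∀ x y, QuadraticMap.polar Q (φ.symm x) (φ.symm y) =
      ∑ i, (x.1 i * y.2 i + y.1 i * x.2 i) := by
    intro x y
    rw [← polar_hyperbolicNorm]
    simp only [QuadraticMap.polar, ← map_add, hQ]
  refine ⟨fun i => φ.symm (G i), fun i => φ.symm (G' i), ?_, ?_, ?_⟩
  · constructor <;> simp [hQ, hp, hyperbolicNorm, Fin.sum_univ_four, G]
  · constructor <;> simp [hQ, hp, hyperbolicNorm, Fin.sum_univ_four, G']
  · intro i j
    rw [hp, Fin.sum_univ_four]
    fin_cases i <;> fin_cases j <;> simp [G, G']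

end TwoQuadrics

/-! ### Maximality of the partial ovoid and of the partial spread -/

section Maximality

variable {K V : Type*} [Field K] [AddCommGroup V] [Module K V]

theorem isTotallySingular_span_sup_span {Q : QuadraticForm K V} {x y : V} (hx : Q x = 0)
    (hy : Q y = 0) (hxy : QuadraticMap.polar Q x y = 0) :
    IsTotallySingular Q ((K ∙ x) ⊔ (K ∙ y)) := by
  intro v hv
  obtain ⟨_, h1, _, h2, rfl⟩ := Submodule.mem_sup.1 hv
  obtain ⟨a, rfl⟩ := Submodule.mem_span_singleton.1 h1
  obtain ⟨b, rfl⟩ := Submodule.mem_span_singleton.1 h2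
  simp [QuadraticMap.map_add Q, QuadraticMap.map_smul, hx, hy, hxy]

/-- A further singular point would be perpendicular to some `w i` and lie with it in a maximal
totally singular subspace. -/
theorem maximal_isPartialOvoid_range [Finite V] {Q : QuadraticForm K V} {ι : Type*} {w : ι → V}
    (hw0 : ∀ i, w i ≠ 0) (hwQ : ∀ i, Q (w i) = 0)
    (hww : ∀ i j, i ≠ j → QuadraticMap.polar Q (w i) (w j) ≠ 0)
    (hmax : ∀ z, ∃ i, QuadraticMap.polar Q z (w i) = 0) :
    Maximal (IsPartialOvoid Q) (Set.range fun i => K ∙ w i) := by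
  refine ⟨⟨?_, ?_⟩, ?_⟩
  · rintro _ ⟨i, rfl⟩
    exact isSingularPoint_span (hw0 i) (hwQ i)
  · rintro M hM _ ⟨i, rfl⟩ _ ⟨j, rfl⟩ hi hj
    by_contra hij
    refine hww i j (fun h => hij (h ▸ rfl)) (hM.prop.polar_eq_zero ?_ ?_)
    · exact hi (Submodule.mem_span_singleton_self _)
    · exact hj (Submodule.mem_span_singleton_self _)
  · intro Ω' hΩ' hle P hP
    obtain ⟨z, hz0, hQz, rfl⟩ := (hΩ'.isSingularPoint P hP).exists_generator
    obtain ⟨i, hi⟩ := hmax z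
    obtain ⟨M, hM, hMmax⟩ := Set.Finite.exists_le_maximal
      (Set.toFinite {W : Submodule K V | IsTotallySingular Q W})
      (isTotallySingular_span_sup_span hQz (hwQ i) hi)
    exact ⟨i, (hΩ'.at_most_one M hMmax _ hP _ (hle ⟨i, rfl⟩) (le_sup_left.trans hM)
      (le_sup_right.trans hM)).symm⟩

/-- On `W` the form is additive, and every scalar is a square; so the singular vectors form a
subspace of codimension at most 1. -/
theorem exists_isTotallySingular_le_of_isTotallyIsotropic [Finite K] (h2 : ringChar K = 2)
    {Q : QuadraticForm K V} {W : Submodule K V} (hW : IsTotallyIsotropic Q.polarBilin W)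
    (hW4 : Module.finrank K W = 4) :
    ∃ W₀ ≤ W, IsTotallySingular Q W₀ ∧ Module.finrank K W₀ = 3 := by
  have : FiniteDimensional K W := Module.finite_of_finrank_pos (by rw [hW4]; norm_num)
  by_cases hts : IsTotallySingular Q W
  · obtain ⟨W₀, hle, h3⟩ := exists_le_finrank_eq hW4 (by norm_num) (by norm_num : 3 ≤ 4)
    exact ⟨W₀, hle, hts.mono hle, h3⟩
  · have : ∃ w ∈ W, Q w ≠ 0 := by simpa [IsTotallySingular] using hts
    obtain ⟨w, hw, hQw⟩ := this
    have hadd : ∀ u ∈ W, ∀ v ∈ W, Q (u + v) = Q u + Q v := fun u hu v hv => by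
      have : QuadraticMap.polar Q u v = 0 := hW u hu v hv
      rw [QuadraticMap.map_add Q, this, add_zero]
    let S : Submodule K V :=
      { carrier := {v | v ∈ W ∧ Q v = 0}
        add_mem' := fun {u v} hu hv =>
          ⟨W.add_mem hu.1 hv.1, by rw [hadd u hu.1 v hv.1, hu.2, hv.2, add_zero]⟩
        zero_mem' := ⟨W.zero_mem, Q.map_zero⟩
        smul_mem' := fun c v hv =>
          ⟨W.smul_mem c hv.1, by rw [QuadraticMap.map_smul, hv.2, smul_zero]⟩ }
    have hSW : S ≤ W := fun v hv => hv.1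
    have : FiniteDimensional K S := Submodule.finiteDimensional_of_le hSW
    have hle : W ≤ S ⊔ (K ∙ w) := by
      intro v hv
      obtain ⟨c, hc⟩ := FiniteField.isSquare_of_char_two h2 (Q v / Q w)
      have hmem : v - c • w ∈ S := by
        refine ⟨W.sub_mem hv (W.smul_mem c hw), ?_⟩
        have := hadd (v - c • w) (W.sub_mem hv (W.smul_mem c hw)) (c • w) (W.smul_mem c hw)
        rw [sub_add_cancel, QuadraticMap.map_smul, ← hc, smul_eq_mul, div_mul_cancel₀ _ hQw] at this
        simpa using this
      rw [← sub_add_cancel v (c • w)]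
      exact Submodule.add_mem_sup hmem
        (Submodule.smul_mem _ _ (Submodule.mem_span_singleton_self w))
    have h1 := Submodule.finrank_mono hle
    have h3 := Submodule.finrank_add_le_finrank_add_finrank S (K ∙ w)
    have h4 := finrank_span_singleton (K := K) (v := w) (by rintro rfl; simp at hQw)
    obtain ⟨W₀, hW₀, h⟩ := exists_le_finrank_eq (W := S) rfl (by omega)
      (by omega : 3 ≤ Module.finrank K S)
    exact ⟨W₀, hW₀.trans hSW, fun v hv => (hW₀ hv).2, h⟩

namespace IsOPlus8

variable {Q : QuadraticForm K V} {m : V →ₗ[K] V →ₗ[K] V}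

theorem leftSpace_eq_or_inf_ne_bot (hQ : IsOPlus8 Q) (hm : IsSymmetricComposition Q m) {x y : V}
    (hx : x ≠ 0) (hQx : Q x = 0) (hy : y ≠ 0) (hQy : Q y = 0)
    (hxy : QuadraticMap.polar Q x y = 0) :
    leftSpace m x = leftSpace m y ∨ leftSpace m x ⊓ leftSpace m y ≠ ⊥ := by
  by_cases hc : ∃ c : K, x = c • y
  · obtain ⟨c, rfl⟩ := hc
    exact Or.inl (leftSpace_smul m (by rintro rfl; simp at hx) y)
  · push Not at hc
    refine Or.inr fun h => ?_
    have := hQ.finrank_leftSpace_inf_eq_two hm hQx hy hQy hxy hc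
    rw [h, finrank_bot] at this
    omega

theorem leftSpace_ne_bot (hQ : IsOPlus8 Q) (hm : IsSymmetricComposition Q m) {x : V}
    (hx : x ≠ 0) (hQx : Q x = 0) : leftSpace m x ≠ ⊥ := by
  intro h
  have := hQ.finrank_leftSpace hm hx hQx
  rw [h, finrank_bot] at this
  omega

/-- The product x * y lies in both spaces; if it is 0, they meet in a 3-space. -/
theorem leftSpace_inf_flip_ne_bot (hQ : IsOPlus8 Q) (hm : IsSymmetricComposition Q m) {x y : V}
    (hx : x ≠ 0) (hQx : Q x = 0) (hy : y ≠ 0) (hQy : Q y = 0) :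
    leftSpace m x ⊓ leftSpace m.flip y ≠ ⊥ := by
  intro h
  by_cases hxy : m x y = 0
  · have := hQ.finrank_inf_flip_eq_three hm hx hQx hy hQy hxy
    rw [h, finrank_bot] at this
    omega
  · apply hxy
    rw [← Submodule.mem_bot K, ← h]
    exact ⟨⟨y, rfl⟩, ⟨x, rfl⟩⟩

variable {ι : Type*} {w : ι → V}

theorem leftSpace_comp_injective (hQ : IsOPlus8 Q) (hm : IsSymmetricComposition Q m)
    (hw0 : ∀ i, w i ≠ 0) (hwQ : ∀ i, Q (w i) = 0)
    (hww : ∀ i j, i ≠ j → QuadraticMap.polar Q (w i) (w j) ≠ 0) :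
    Function.Injective fun i => leftSpace m (w i) := by
  intro i j h
  by_contra hij
  have hb := hQ.leftSpace_inf_eq_bot hm (hw0 i) (hwQ i) (hw0 j) (hwQ j) (hww i j hij)
  rw [← show leftSpace m (w i) = leftSpace m (w j) from h, inf_idem] at hb
  exact hQ.leftSpace_ne_bot hm (hw0 i) (hwQ i) hb

theorem isPartialSpread_range (hQ : IsOPlus8 Q) (hm : IsSymmetricComposition Q m)
    (hw0 : ∀ i, w i ≠ 0) (hwQ : ∀ i, Q (w i) = 0)
    (hww : ∀ i j, i ≠ j → QuadraticMap.polar Q (w i) (w j) ≠ 0) :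
    IsPartialSpread (Set.range fun i => leftSpace m (w i)) where
  finrank_eq := by
    rintro _ ⟨i, rfl⟩
    rw [hQ.finrank_leftSpace hm (hw0 i) (hwQ i), hQ.finrank_eq]
  inf_eq_bot := by
    rintro _ ⟨i, rfl⟩ _ ⟨j, rfl⟩ hij
    exact hQ.leftSpace_inf_eq_bot hm (hw0 i) (hwQ i) (hw0 j) (hwQ j)
      (hww i j fun h => hij (h ▸ rfl))

theorem maximal_isOrthogonalPartialSpread_range (hQ : IsOPlus8 Q) (hm : IsSymmetricComposition Q m)
    (hw0 : ∀ i, w i ≠ 0) (hwQ : ∀ i, Q (w i) = 0)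
    (hww : ∀ i j, i ≠ j → QuadraticMap.polar Q (w i) (w j) ≠ 0)
    (hmax : ∀ z, ∃ i, QuadraticMap.polar Q z (w i) = 0) :
    Maximal (IsOrthogonalPartialSpread Q) (Set.range fun i => leftSpace m (w i)) := by
  refine ⟨⟨hQ.isPartialSpread_range hm hw0 hwQ hww, ?_⟩, ?_⟩
  · rintro _ ⟨i, rfl⟩
    exact hm.isTotallySingular_leftSpace (hwQ i)
  · intro S' hS' hle W hW
    have h4 := hS'.isPartialSpread.finrank_eq W hW
    rw [hQ.finrank_eq] at h4
    have hdisj : ∀ i, W ≠ leftSpace m (w i) → W ⊓ leftSpace m (w i) = ⊥ := fun i hi =>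
      hS'.isPartialSpread.inf_eq_bot W hW _ (hle ⟨i, rfl⟩) hi
    obtain ⟨x, hx, hQx, rfl | rfl⟩ := hQ.eq_leftSpace_or_eq_flip hm
      (hS'.isTotallySingular W hW) (by omega)
    · obtain ⟨i, hi⟩ := hmax x
      refine ⟨i, ?_⟩
      by_contra hne
      rcases hQ.leftSpace_eq_or_inf_ne_bot hm hx hQx (hw0 i) (hwQ i) hi with h | h
      · exact hne h.symm
      · exact h (hdisj i fun h => hne h.symm)
    -- Only the existence of an index is needed: a 4-space of the other type meets every member.
    · obtain ⟨i, -⟩ := hmax 0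
      refine (hQ.leftSpace_inf_flip_ne_bot hm (hw0 i) (hwQ i) hx hQx ?_).elim
      rw [inf_comm]
      exact hdisj i (hQ.leftSpace_ne_flip hm (hw0 i) (hwQ i) hx hQx).symm

theorem maximal_isSymplecticPartialSpread_range [Finite K] (hQ : IsOPlus8 Q)
    (hm : IsSymmetricComposition Q m) (h2 : ringChar K = 2)
    (hw0 : ∀ i, w i ≠ 0) (hwQ : ∀ i, Q (w i) = 0)
    (hww : ∀ i j, i ≠ j → QuadraticMap.polar Q (w i) (w j) ≠ 0)
    (hmax : ∀ z, ∃ i, QuadraticMap.polar Q z (w i) = 0) :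
    Maximal (IsSymplecticPartialSpread Q.polarBilin) (Set.range fun i => leftSpace m (w i)) := by
  have := hQ.finiteDimensional
  refine ⟨⟨hQ.isPartialSpread_range hm hw0 hwQ hww, ?_⟩, ?_⟩
  · rintro _ ⟨i, rfl⟩ u hu v hv
    exact (hm.isTotallySingular_leftSpace (hwQ i)).polar_eq_zero hu hv
  · intro S' hS' hle W hW
    by_contra hWS
    have h4 := hS'.isPartialSpread.finrank_eq W hW
    rw [hQ.finrank_eq] at h4
    obtain ⟨W₀, hW₀, hts, h3⟩ := exists_isTotallySingular_le_of_isTotallyIsotropic h2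
      (hS'.isTotallyIsotropic W hW) (by omega)
    obtain ⟨x, -, hx, hQx, -, -, -, hW₀x, -⟩ := hQ.exists_le_leftSpace_le_flip hm hts h3
    obtain ⟨i, hi⟩ := hmax x
    have hdisj : W ⊓ leftSpace m (w i) = ⊥ :=
      hS'.isPartialSpread.inf_eq_bot W hW _ (hle ⟨i, rfl⟩) fun h => hWS ⟨i, h.symm⟩
    have heven := hQ.even_finrank_leftSpace_inf hm hx hQx (hw0 i) (hwQ i)
    have hbot : W₀ ⊓ (leftSpace m x ⊓ leftSpace m (w i)) = ⊥ :=
      eq_bot_iff.2 (hdisj ▸ inf_le_inf hW₀ inf_le_right)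
    have hsum := Submodule.finrank_sup_add_finrank_inf_eq W₀ (leftSpace m x ⊓ leftSpace m (w i))
    have hle4 := Submodule.finrank_mono (sup_le hW₀x inf_le_left :
      W₀ ⊔ (leftSpace m x ⊓ leftSpace m (w i)) ≤ leftSpace m x)
    rw [hbot, finrank_bot, h3] at hsum
    rw [hQ.finrank_leftSpace hm hx hQx] at hle4
    -- Inside the 4-space x * V the 3-space `W₀` leaves room for dimension at most 1, and the
    -- intersection has even dimension. This contradicts that x and `w i` are perpendicular.
    have hzero : Module.finrank K ↥(leftSpace m x ⊓ leftSpace m (w i)) = 0 := by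
      obtain ⟨k, hk⟩ := heven
      omega
    rw [Submodule.finrank_eq_zero] at hzero
    rcases hQ.leftSpace_eq_or_inf_ne_bot hm hx hQx (hw0 i) (hwQ i) hi with h | h
    · rw [← h, inf_idem] at hzero
      exact hQ.leftSpace_ne_bot hm hx hQx hzero
    · exact h hzero

theorem trialityImage_range (hQ : IsOPlus8 Q) (hm : IsSymmetricComposition Q m)
    (hw0 : ∀ i, w i ≠ 0) (hwQ : ∀ i, Q (w i) = 0) :
    trialityImage Q (hQ.triality hm) (Set.range fun i => K ∙ w i) =
      Set.range fun i => leftSpace m (w i) := by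
  ext W
  constructor
  · rintro ⟨X, ⟨i, hi⟩, rfl⟩
    exact ⟨i, (hQ.triality_coe_of_eq_span hm (hw0 i) hi.symm).symm⟩
  · rintro ⟨i, rfl⟩
    have hP := isSingularPoint_span (hw0 i) (hwQ i)
    exact ⟨⟨K ∙ w i, hP.1, Or.inl hP.2⟩, ⟨i, rfl⟩, hQ.triality_coe_of_eq_span hm (hw0 i) rfl⟩

end IsOPlus8

end Maximality
end OrthogonalGeometry

/-! ### Assembly of the main theorem -/

theorem mainTheorem12 {K V : Type*} [Field K] [Finite K] [AddCommGroup V] [Module K V]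
    (q : ℕ) (hq : Nat.card K = q) (Q : QuadraticForm K V) (hQ : OrthogonalGeometry.IsOPlus8 Q) :
    ∃ S : Set (Submodule K V),
      Maximal (OrthogonalGeometry.IsOrthogonalPartialSpread Q) S ∧
      S.ncard = 2 * q ^ 2 + 1 ∧
      (Even q → Maximal (OrthogonalGeometry.IsSymplecticPartialSpread Q.polarBilin) S) ∧
      ∃ (Ω : Set (Submodule K V)) (τ : Equiv.Perm (OrthogonalGeometry.Element Q)),
        OrthogonalGeometry.IsTwoQuadricConfiguration Q Ω ∧
        Maximal (OrthogonalGeometry.IsPartialOvoid Q) Ω ∧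
        OrthogonalGeometry.IsTriality Q τ ∧
        S = OrthogonalGeometry.trialityImage Q τ Ω := by
  have := hQ.finiteDimensional
  have : Finite V := Module.finite_of_finite K
  obtain ⟨W, hW, hW4⟩ := hQ.wittIndex.1
  obtain ⟨φ, hφ⟩ := OrthogonalGeometry.exists_hyperbolic_coordinates hQ.finrank_eq
    hQ.nondegenerate hW hW4
  obtain ⟨m, hm⟩ := OrthogonalGeometry.exists_isSymmetricComposition hφ
  obtain ⟨c, hc⟩ := OrthogonalGeometry.exists_forall_sq_add_self_add_ne_zero K
  obtain ⟨F, F', hF, hF', hx⟩ := OrthogonalGeometry.exists_linked_frames hφ c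
  have h1 : (1 : K) ≠ 0 := one_ne_zero
  have h1' : (-1 : K) ≠ 0 := neg_ne_zero.2 one_ne_zero
  have hw0 := hF.configurationVector_ne_zero hF' h1 h1' hc hx
  have hwQ := hF.map_configurationVector hF' hx
  have hww := fun i j => hF.polar_configurationVector_ne_zero hF' h1 h1' hc hx (i := i) (j := j)
  have hmax := OrthogonalGeometry.IsEllipticFrame.exists_polar_configurationVector_eq_zero
    h1 h1' hc Q F F'
  refine ⟨_, hQ.maximal_isOrthogonalPartialSpread_range hm hw0 hwQ hww hmax, ?_, fun hq2 => ?_,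
    OrthogonalGeometry.configuration c 1 (-1) F F', hQ.triality hm,
    hF.isTwoQuadricConfiguration hF' h1 h1' hc hx,
    OrthogonalGeometry.maximal_isPartialOvoid_range hw0 hwQ hww hmax,
    hQ.isTriality_triality hm, (hQ.trialityImage_range hm hw0 hwQ).symm⟩
  · rw [← Set.image_univ,
      Set.ncard_image_of_injective _ (hQ.leftSpace_comp_injective hm hw0 hwQ hww),
      Set.ncard_univ, Finite.card_option, Nat.card_sum, Nat.card_prod, hq]
    ring
  · have := Fintype.ofFinite K
    refine hQ.maximal_isSymplecticPartialSpread_range hm ?_ hw0 hwQ hww hmax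
    rw [FiniteField.even_card_iff_char_two, ← Nat.card_eq_fintype_card, hq]
    exact Nat.even_iff.1 hq2
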